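/- Let $\mathbb K\in\{\mathbb R,\mathbb C\}$ and let $(X,\|\cdot\|,\tau)$ be a bi-admissible space, i.e. $(X,\|\cdot\|)$ is a Banach space over $\mathbb K$ and $\tau$ is a locally convex Hausdorff topology on $X$ which is coarser than the norm topology, for which every $\|\cdot\|$-bounded $\tau$-Cauchy sequence is $\tau$-convergent, and whose dual is norming, i.e. $\|x\|=\sup\{|\varphi(x)|:\varphi\in(X,\tau)',\ \|\varphi\|\le 1\}$ for all $x\in X$. Let $A\colon \mathrm D(A)\subseteq X\to X$ be a linear operator on $X$ such that * $A$ is bi-dissipative: there is a set $\Gamma$ of $\tau$-continuous seminorms on $X$ that is a fundamental system for $\tau$ (every $\tau$-neighbourhood of $0$ contains $\{x: p(x)<\varepsilon\}$ for some $p\in\Gamma$, $\varepsilon>0$), such that $p((\lambda-A)x)\ge\lambda p(x)$ for all $\lambda>0$, $p\in\Gamma$, $x\in\mathrm D(A)$, and $\|x\|=\sup_{p\in\Gamma}p(x)$ for all $x\in X$; * $A$ is bi-densely defined: for each $x\in X$ there is a $\|\cdot\|$-bounded sequence in $\mathrm D(A)$ that $\tau$-converges to $x$; * $A$ is closed, i.e.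 its graph is closed in $X\times X$ for the norm topology. Then the following are equivalent: (a) $A$ generates a bi-continuous contraction semigroup on $X$. (b) There is $\lambda>0$ such that $\lambda-A\colon \mathrm D(A)\to X$ is surjective. Here a bi-continuous semigroup is a family $(T(t))_{t\ge0}$ of bounded linear operators on $X$ with $T(0)=I$, $T(t+s)=T(t)T(s)$ for all $s,t\ge 0$; such that $t\mapsto T(t)x$ is $\tau$-continuous on $[0,\infty)$ for each $x\in X$; such that $\|T(t)\|\le Me^{\omega t}$ for all $t\ge 0$, for some $M\ge1$ and $\omega\in\mathbb R$; and such that for each $\|\cdot\|$-bounded $\tau$-null sequence $(x_n)$ and each $t_0\ge0$ one has $T(s)x_n\to0$ in $\tau$ uniformly for $s\in[0,t_0]$. It is a contraction semigroup if $\|T(t)\|\le1$ for all $t\ge0$. Its generator is the operator $Ax=\tau\text{-}\lim_{t\downarrow0}\frac{T(t)x-x}{t}$ whose domain consists of all $x\in X$ for which this $\tau$-limit exists and $\sup_{t\in(0,1]}\frac{\|T(t)x-x\|}{t}<\infty$. -/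

import Mathlib

open Filter Topology

namespace BiCont

/-- An additional topology on `X`. It is wrapped in a structure so that it is never picked up by
instance resolution: on a normed space `X`, the instance topology is always that of the norm. -/
structure AuxTopology (X : Type*) where
  /-- the underlying topology -/
  top : TopologicalSpace X

variable {𝕜 X : Type*} [RCLike 𝕜] [NormedAddCommGroup X] [NormedSpace 𝕜 X]

/-- A sequence that is bounded in norm. -/
def NormBounded (u : ℕ → X) : Prop :=
  ∃ C : ℝ, ∀ n, ‖u n‖ ≤ C

variable (𝕜) in
/-- `(X, ‖·‖, τ)` is a bi-admissible space (the completeness of the normed space `X` is the separate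
instance `CompleteSpace X`). In Mathlib's order on topologies `t ≤ s` means that `s` is coarser. -/
structure IsBiAdmissible (τ : AuxTopology X) : Prop where
  /-- `τ` is a locally convex vector space topology, i.e. it is induced by seminorms. -/
  locallyConvex : @PolynormableSpace 𝕜 X _ _ _ τ.top
  hausdorff : @T2Space X τ.top
  coarser : (inferInstance : TopologicalSpace X) ≤ τ.top
  /-- Every norm-bounded `τ`-Cauchy sequence is `τ`-convergent. -/
  seqComplete : ∀ u : ℕ → X, NormBounded u →
    Tendsto (fun mn : ℕ × ℕ => u mn.1 - u mn.2) atTop (@nhds X τ.top 0) →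
    ∃ x : X, Tendsto u atTop (@nhds X τ.top x)
  /-- The dual of `(X, τ)` is norming. (A `τ`-continuous functional is norm-continuous, as `τ` is
  coarser than the norm topology, so the `φ` below are all the elements of the dual of `(X, τ)`
  whose dual norm is at most one.) -/
  norming : ∀ x : X,
    IsLUB {r : ℝ | ∃ φ : X →L[𝕜] 𝕜, Continuous[τ.top, inferInstance] φ ∧ ‖φ‖ ≤ 1 ∧ r = ‖φ x‖} ‖x‖

/-- `(T(t))_{t ≥ 0}` is a bi-continuous semigroup with respect to `τ`. -/
structure IsBiContinuousSemigroup (τ : AuxTopology X) (T : NNReal → X →L[𝕜] X) : Prop where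
  map_add : ∀ t s : NNReal, T (t + s) = (T t).comp (T s)
  map_zero : T 0 = ContinuousLinearMap.id 𝕜 X
  stronglyContinuous : ∀ x : X, Continuous[inferInstance, τ.top] (fun t : NNReal => T t x)
  exponentiallyBounded : ∃ M ω : ℝ, 1 ≤ M ∧ ∀ t : NNReal, ‖T t‖ ≤ M * Real.exp (ω * t)
  /-- For norm-bounded `τ`-null sequences `u`, the sequence `T s (u n)` is `τ`-null uniformly for
  `s` in bounded intervals. -/
  locallyBiEquicontinuous : ∀ u : ℕ → X, NormBounded u → Tendsto u atTop (@nhds X τ.top 0) →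
    ∀ t₀ : NNReal, ∀ U ∈ @nhds X τ.top 0, ∀ᶠ n in atTop, ∀ s : NNReal, s ≤ t₀ → T s (u n) ∈ U

/-- The difference quotient `(T(t)x - x) / t` tends to `y` with respect to `τ` as `t ↓ 0`. -/
def HasTauDerivAtZero (τ : AuxTopology X) (T : NNReal → X →L[𝕜] X) (x y : X) : Prop :=
  Tendsto (fun t : NNReal => (((t : ℝ) : 𝕜)⁻¹) • (T t x - x)) (𝓝[>] 0) (@nhds X τ.top y)

/-- `A` is the (infinitesimal) generator of `T`. -/
structure IsGenerator (τ : AuxTopology X) (T : NNReal → X →L[𝕜] X) (A : X →ₗ.[𝕜] X) :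
    Prop where
  mem_domain_iff : ∀ x : X, x ∈ A.domain ↔
    (∃ y : X, HasTauDerivAtZero τ T x y) ∧
      ∃ C : ℝ, ∀ t : NNReal, 0 < t → t ≤ 1 → ‖T t x - x‖ / (t : ℝ) ≤ C
  hasTauDeriv : ∀ x : A.domain, HasTauDerivAtZero τ T (x : X) (A x)

/-- `A` generates a bi-continuous contraction semigroup. -/
def GeneratesContractionSemigroup (τ : AuxTopology X) (A : X →ₗ.[𝕜] X) : Prop :=
  ∃ T : NNReal → X →L[𝕜] X,
    IsBiContinuousSemigroup τ T ∧ (∀ t, ‖T t‖ ≤ 1) ∧ IsGenerator τ T A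

/-- The domain of `A` is bi-dense. -/
def BiDenselyDefined (τ : AuxTopology X) (A : X →ₗ.[𝕜] X) : Prop :=
  ∀ x : X, ∃ u : ℕ → X, (∀ n, u n ∈ A.domain) ∧ NormBounded u ∧ Tendsto u atTop (@nhds X τ.top x)

/-- `Γ` is a fundamental system of seminorms for `τ`: its members are `τ`-continuous, and their
unit balls form, up to scaling, a base of neighbourhoods of zero. -/
structure IsFundamentalSystem (τ : AuxTopology X) (Γ : Set (Seminorm 𝕜 X)) : Prop where
  continuous : ∀ p ∈ Γ, Continuous[τ.top, inferInstance] p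
  exists_ball_subset : ∀ U ∈ @nhds X τ.top 0, ∃ p ∈ Γ, ∃ ε : ℝ, 0 < ε ∧ {x : X | p x < ε} ⊆ U

/-- `A` is bi-dissipative. -/
def BiDissipative (τ : AuxTopology X) (A : X →ₗ.[𝕜] X) : Prop :=
  ∃ Γ : Set (Seminorm 𝕜 X), IsFundamentalSystem τ Γ ∧
    (∀ l : ℝ, 0 < l → ∀ p ∈ Γ, ∀ x : A.domain, l * p (x : X) ≤ p ((l : 𝕜) • (x : X) - A x)) ∧
    ∀ x : X, IsLUB {r : ℝ | ∃ p ∈ Γ, r = p x} ‖x‖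

end BiCont

/-!
Dissipativity makes `l * (l - A)⁻¹` contractive for every seminorm of the fundamental system, hence
for the norm, and a Neumann series argument propagates surjectivity of `l - A` to all `l > 0`. The
Yosida approximations of `A` are bounded and commute, and they generate groups that are contractive
in positive time for the same seminorms; by density of the domain and completeness on norm-bounded
sets these groups converge to a contraction semigroup. Its generator extends `A`, and coincides
with `A` because it has no positive eigenvalue while `l - A` is onto.

Conversely, let `A` generate `T` and put `S(t) = e^(-l t) T(t)`. The integral `J` of `S(t) z` over
`[0, r]`, obtained as a limit of Riemann sums, lies in the domain of `A` and satisfies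
`(l - A) J = z - S(r) z`. If `‖S(r)‖ < 1`, then `1 - S(r)` is onto by the Neumann series, and so
is `l - A`.
-/

namespace BiCont

variable {𝕜 X : Type*} [RCLike 𝕜] [NormedAddCommGroup X] [NormedSpace 𝕜 X]

/-! ### Convergence with respect to a set of seminorms -/

section SeminormTendsto

variable {E ι : Type*} [AddCommGroup E] [Module 𝕜 E]

/-- Convergence of `u` to `x` along `l` with respect to every seminorm in `Γ`. This is how
`τ`-convergence is handled throughout, with `Γ` a fundamental system for `τ`. -/
def SeminormTendsto (Γ : Set (Seminorm 𝕜 E)) (u : ι → E) (l : Filter ι) (x : E) : Prop :=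
  ∀ p ∈ Γ, Tendsto (fun i => p (u i - x)) l (𝓝 0)

/-- Continuity of `f` with respect to every seminorm in `Γ`. -/
def SeminormContinuous [TopologicalSpace ι] (Γ : Set (Seminorm 𝕜 E)) (f : ι → E) : Prop :=
  ∀ t, SeminormTendsto Γ f (𝓝 t) (f t)

/-- The set `D` is dense for every seminorm in `Γ`. -/
def IsSeminormDense (Γ : Set (Seminorm 𝕜 E)) (D : Set E) : Prop :=
  ∀ p ∈ Γ, ∀ x, ∀ ε > 0, ∃ v ∈ D, p (v - x) < ε

variable {Γ : Set (Seminorm 𝕜 E)} {l : Filter ι} {u v : ι → E} {x y : E}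

namespace SeminormTendsto

protected theorem const (x : E) : SeminormTendsto Γ (fun _ : ι => x) l x := fun p _ => by
  simpa using tendsto_const_nhds

theorem tendsto_seminorm (h : SeminormTendsto Γ u l x) {p : Seminorm 𝕜 E} (hp : p ∈ Γ) :
    Tendsto (fun i => p (u i)) l (𝓝 (p x)) := by
  rw [tendsto_iff_norm_sub_tendsto_zero]
  exact squeeze_zero (fun _ => norm_nonneg _) (fun i => abs_sub_map_le_sub p _ _) (h p hp)

protected theorem add (hu : SeminormTendsto Γ u l x) (hv : SeminormTendsto Γ v l y) :
    SeminormTendsto Γ (fun i => u i + v i) l (x + y) := by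
  intro p hp
  have hsum := (hu p hp).add (hv p hp)
  rw [add_zero] at hsum
  refine squeeze_zero (fun _ => apply_nonneg p _) (fun i => ?_) hsum
  rw [add_sub_add_comm]
  exact map_add_le_add p _ _

protected theorem smul {c : ι → 𝕜} {a : 𝕜} (hc : Tendsto c l (𝓝 a))
    (hu : SeminormTendsto Γ u l x) : SeminormTendsto Γ (fun i => c i • u i) l (a • x) := by
  intro p hp
  have hsum := (hc.norm.mul (hu p hp)).add
    ((tendsto_iff_norm_sub_tendsto_zero.1 hc).mul_const (p x))
  rw [mul_zero, zero_mul, add_zero] at hsum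
  refine squeeze_zero (fun _ => apply_nonneg p _) (fun i => ?_) hsum
  have hsplit : c i • u i - a • x = c i • (u i - x) + (c i - a) • x := by module
  rw [hsplit, ← map_smul_eq_mul, ← map_smul_eq_mul]
  exact map_add_le_add p _ _

protected theorem sub (hu : SeminormTendsto Γ u l x) (hv : SeminormTendsto Γ v l y) :
    SeminormTendsto Γ (fun i => u i - v i) l (x - y) := by
  simpa [sub_eq_add_neg] using hu.add (hv.smul (tendsto_const_nhds (x := (-1 : 𝕜))))

theorem cauchy {u : ℕ → E} (h : SeminormTendsto Γ u atTop x) {p : Seminorm 𝕜 E} (hp : p ∈ Γ) :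
    Tendsto (fun mn : ℕ × ℕ => p (u mn.1 - u mn.2)) atTop (𝓝 0) := by
  have hfst : SeminormTendsto Γ (fun mn : ℕ × ℕ => u mn.1) (atTop ×ˢ atTop) x :=
    fun q hq => (h q hq).comp tendsto_fst
  have hsnd : SeminormTendsto Γ (fun mn : ℕ × ℕ => u mn.2) (atTop ×ˢ atTop) x :=
    fun q hq => (h q hq).comp tendsto_snd
  rw [← prod_atTop_atTop_eq]
  simpa using (hfst.sub hsnd).tendsto_seminorm hp

end SeminormTendsto

/-- The three-epsilon argument, for `v` in the dense set close to `x`. -/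
theorem IsSeminormDense.tendsto_zero {D : Set E} (hD : IsSeminormDense Γ D)
    {p : Seminorm 𝕜 E} (hp : p ∈ Γ) (x : E) {F : ι → ℝ} {G : D → ι → ℝ} (hF : ∀ i, 0 ≤ F i)
    (hG : ∀ v, Tendsto (G v) l (𝓝 0))
    (hFG : ∀ v : D, ∀ᶠ i in l, F i ≤ 2 * p (v - x) + G v i) : Tendsto F l (𝓝 0) := by
  rw [Metric.tendsto_nhds]
  intro ε hε
  obtain ⟨v, hv, hvx⟩ := hD p hp x (ε / 3) (by positivity)
  filter_upwards [hFG ⟨v, hv⟩, (hG ⟨v, hv⟩).eventually_lt_const (show 0 < ε / 3 by positivity)]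
    with i hi hGi
  rw [Real.dist_eq, sub_zero, abs_of_nonneg (hF i)]
  linarith

theorem exists_functional_eq_seminorm (p : Seminorm 𝕜 E) (x : E) :
    ∃ φ : E →ₗ[𝕜] 𝕜, ‖φ x‖ = p x ∧ ∀ y, ‖φ y‖ ≤ p y := by
  have hnorm (c : 𝕜) : ‖c • (p x : 𝕜)‖ = p (c • x) := by
    rw [norm_smul, RCLike.norm_ofReal, abs_of_nonneg (apply_nonneg p x), map_smul_eq_mul]
  have hwell (c : 𝕜) (hc : c • x = 0) : c • (p x : 𝕜) = 0 := by
    rw [← norm_eq_zero, hnorm, hc, map_zero]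
  obtain ⟨φ, hφ, hφp⟩ := Module.Dual.exists_extension_of_le_seminorm (𝕜 ∙ x)
    (LinearPMap.mkSpanSingleton' x (p x : 𝕜) hwell).toFun (p := p) (by
      rintro ⟨y, hy⟩
      obtain ⟨c, rfl⟩ := Submodule.mem_span_singleton.1 hy
      exact ((congrArg norm (LinearPMap.mkSpanSingleton'_apply x _ hwell c hy)).trans
        (hnorm c)).le)
  have hφx : φ x = (p x : 𝕜) := (hφ ⟨x, Submodule.mem_span_singleton_self x⟩).trans
    (LinearPMap.mkSpanSingleton'_apply_self x _ hwell _)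
  refine ⟨φ, ?_, hφp⟩
  rw [hφx, RCLike.norm_ofReal, abs_of_nonneg (apply_nonneg p x)]

theorem seminorm_inv_smul_sub_le {p : Seminorm 𝕜 E} {t c : ℝ} (ht : 0 < t)
    (h : p (x - (t : 𝕜) • y) ≤ t * c) : p ((t : 𝕜)⁻¹ • x - y) ≤ c := by
  have hsplit : (t : 𝕜)⁻¹ • x - y = (t : 𝕜)⁻¹ • (x - (t : 𝕜) • y) := by
    rw [smul_sub, inv_smul_smul₀ (RCLike.ofReal_ne_zero.2 ht.ne')]
  rwa [hsplit, map_smul_eq_mul, norm_inv, RCLike.norm_ofReal, abs_of_pos ht, inv_mul_le_iff₀ ht]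

end SeminormTendsto

section Norming

variable {Γ : Set (Seminorm 𝕜 X)}

/-- The norm is the supremum of the seminorms in `Γ`. -/
def IsNorming (Γ : Set (Seminorm 𝕜 X)) : Prop :=
  ∀ x : X, IsLUB {r : ℝ | ∃ p ∈ Γ, r = p x} ‖x‖

/-- Norm-bounded sequences that are Cauchy for every seminorm in `Γ` converge for all of them. -/
def IsBoundedlyComplete (Γ : Set (Seminorm 𝕜 X)) : Prop :=
  ∀ u : ℕ → X, NormBounded u →
    (∀ p ∈ Γ, Tendsto (fun mn : ℕ × ℕ => p (u mn.1 - u mn.2)) atTop (𝓝 0)) →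
    ∃ x : X, SeminormTendsto Γ u atTop x

theorem IsNorming.le_norm (hN : IsNorming Γ) {p : Seminorm 𝕜 X} (hp : p ∈ Γ) (x : X) :
    p x ≤ ‖x‖ :=
  (hN x).1 ⟨p, hp, rfl⟩

theorem IsNorming.norm_le (hN : IsNorming Γ) {x : X} {C : ℝ} (h : ∀ p ∈ Γ, p x ≤ C) :
    ‖x‖ ≤ C := by
  refine (hN x).2 ?_
  rintro r ⟨p, hp, rfl⟩
  exact h p hp

theorem SeminormTendsto.unique {ι : Type*} {l : Filter ι} [l.NeBot] {u : ι → X} {x y : X}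
    (hN : IsNorming Γ) (hx : SeminormTendsto Γ u l x) (hy : SeminormTendsto Γ u l y) :
    x = y := by
  rw [← sub_eq_zero, ← norm_le_zero_iff]
  refine hN.norm_le fun p hp => ?_
  have hlim := (hx.sub hy).tendsto_seminorm hp
  simp only [sub_self, map_zero] at hlim
  exact (tendsto_nhds_unique hlim tendsto_const_nhds).le

end Norming

namespace IsFundamentalSystem

variable {τ : AuxTopology X} {Γ : Set (Seminorm 𝕜 X)}

theorem tendsto_nhds_iff (hΓ : IsFundamentalSystem τ Γ)
    (hτ : @PolynormableSpace 𝕜 X _ _ _ τ.top) {ι : Type*} {u : ι → X} {l : Filter ι} {x : X} :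
    Tendsto u l (@nhds X τ.top x) ↔ SeminormTendsto Γ u l x := by
  rw [@WithSeminorms.tendsto_nhds 𝕜 X _ _ _ _ _ τ.top _
    (@PolynormableSpace.withSeminorms 𝕜 X _ _ _ τ.top hτ)]
  constructor
  · intro h p hp
    rw [Metric.tendsto_nhds]
    intro ε hε
    filter_upwards [h ⟨p, hΓ.continuous p hp⟩ ε hε] with i hi
    rwa [Real.dist_eq, sub_zero, abs_of_nonneg (apply_nonneg p _)]
  · rintro h ⟨q, hq⟩ ε hε
    have hball : {y : X | q y < ε} ∈ @nhds X τ.top 0 := by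
      have hq0 : Tendsto q (@nhds X τ.top 0) (𝓝 (q 0)) := @Continuous.tendsto X ℝ τ.top _ q hq 0
      rw [map_zero] at hq0
      exact hq0.eventually_lt_const hε
    obtain ⟨p, hp, δ, hδ, hsub⟩ := hΓ.exists_ball_subset _ hball
    filter_upwards [(h p hp).eventually_lt_const hδ] with i hi
    exact hsub hi

theorem isBoundedlyComplete (hΓ : IsFundamentalSystem τ Γ) (hτ : IsBiAdmissible 𝕜 τ) :
    IsBoundedlyComplete Γ := by
  intro u hu hcauchy
  obtain ⟨x, hx⟩ := hτ.seqComplete u hu <|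
    (hΓ.tendsto_nhds_iff hτ.locallyConvex).2 fun p hp => by simpa using hcauchy p hp
  exact ⟨x, (hΓ.tendsto_nhds_iff hτ.locallyConvex).1 hx⟩

theorem isSeminormDense (hΓ : IsFundamentalSystem τ Γ)
    (hτ : @PolynormableSpace 𝕜 X _ _ _ τ.top) {D : Set X} (hD : @Dense X τ.top D) :
    IsSeminormDense Γ D := by
  intro p hp x ε hε
  have hnear : ∀ᶠ v in @nhds X τ.top x, p (v - x) < ε :=
    ((hΓ.tendsto_nhds_iff hτ).1 tendsto_id p hp).eventually_lt_const hε
  obtain ⟨v, hvx, hvD⟩ := (@mem_closure_iff_nhds X τ.top x D).1 (hD x) _ hnear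
  exact ⟨v, hvD, hvx⟩

end IsFundamentalSystem

/-! ### Dissipative operators and their resolvents -/

section Resolvent

/-- The operator `l - A`, defined on the domain of `A`. -/
def shifted (A : X →ₗ.[𝕜] X) (l : ℝ) : A.domain →ₗ[𝕜] X :=
  (l : 𝕜) • A.domain.subtype - A.toFun

/-- The operator `l - A` is bounded below by `l` for every seminorm in `Γ` and every `l > 0`. -/
def IsDissipativeFor (Γ : Set (Seminorm 𝕜 X)) (A : X →ₗ.[𝕜] X) : Prop :=
  ∀ l : ℝ, 0 < l → ∀ p ∈ Γ, ∀ x : A.domain, l * p (x : X) ≤ p (shifted A l x)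

/-- `R` is the resolvent `(l - A)⁻¹`. -/
structure IsResolvent (A : X →ₗ.[𝕜] X) (l : ℝ) (R : X →L[𝕜] X) : Prop where
  surjective : Function.Surjective (shifted A l)
  left_inv : ∀ x : A.domain, R (shifted A l x) = x

variable {Γ : Set (Seminorm 𝕜 X)} {A : X →ₗ.[𝕜] X} {l m : ℝ} {R S : X →L[𝕜] X}

theorem shifted_apply (A : X →ₗ.[𝕜] X) (l : ℝ) (x : A.domain) :
    shifted A l x = (l : 𝕜) • (x : X) - A x := rfl

theorem shifted_eq_add (A : X →ₗ.[𝕜] X) (l m : ℝ) (x : A.domain) :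
    shifted A m x = shifted A l x + ((m - l : ℝ) : 𝕜) • (x : X) := by
  rw [shifted_apply, shifted_apply, RCLike.ofReal_sub]
  module

theorem IsResolvent.commute (hR : IsResolvent A l R) (hS : IsResolvent A m S) :
    Commute R S := by
  ext y
  obtain ⟨x, rfl⟩ := hS.surjective y
  obtain ⟨w, hw⟩ := hR.surjective x
  have hRx : R x = w := by rw [← hw, hR.left_inv]
  have hRS : R (shifted A m x) = shifted A m w := by
    rw [shifted_eq_add A l m x, shifted_eq_add A l m w, map_add, map_smul, hR.left_inv, hRx, hw]
  change R (S _) = S (R _)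
  rw [hS.left_inv, hRS, hS.left_inv, hRx]

theorem IsResolvent.smul_apply_sub (hR : IsResolvent A l R) (x : A.domain) :
    (l : 𝕜) • R x - x = R (A x) := by
  have h := hR.left_inv x
  rw [shifted_apply, map_sub, map_smul] at h
  linear_combination (norm := module) h

theorem IsResolvent.seminorm_le (hR : IsResolvent A l R) (hA : IsDissipativeFor Γ A)
    (hl : 0 < l) {p : Seminorm 𝕜 X} (hp : p ∈ Γ) (y : X) : l * p (R y) ≤ p y := by
  obtain ⟨x, rfl⟩ := hR.surjective y
  rw [hR.left_inv]
  exact hA l hl p hp x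

theorem IsResolvent.seminorm_smul_le (hR : IsResolvent A l R) (hA : IsDissipativeFor Γ A)
    (hl : 0 < l) {p : Seminorm 𝕜 X} (hp : p ∈ Γ) (y : X) : p ((l : 𝕜) • R y) ≤ p y := by
  rw [map_smul_eq_mul, RCLike.norm_ofReal, abs_of_pos hl]
  exact hR.seminorm_le hA hl hp y

theorem IsDissipativeFor.norm_le (hA : IsDissipativeFor Γ A) (hN : IsNorming Γ) (hl : 0 < l)
    (x : A.domain) : ‖(x : X)‖ ≤ l⁻¹ * ‖shifted A l x‖ := by
  refine hN.norm_le fun p hp => ?_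
  rw [inv_mul_eq_div, le_div_iff₀' hl]
  exact (hA l hl p hp x).trans (hN.le_norm hp _)

theorem IsResolvent.norm_le (hR : IsResolvent A l R) (hA : IsDissipativeFor Γ A)
    (hN : IsNorming Γ) (hl : 0 < l) : ‖R‖ ≤ l⁻¹ := by
  refine R.opNorm_le_bound (inv_nonneg.2 hl.le) fun y => ?_
  obtain ⟨x, rfl⟩ := hR.surjective y
  rw [hR.left_inv]
  exact hA.norm_le hN hl x

theorem IsDissipativeFor.exists_isResolvent (hA : IsDissipativeFor Γ A) (hN : IsNorming Γ)
    (hl : 0 < l) (hs : Function.Surjective (shifted A l)) :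
    ∃ R : X →L[𝕜] X, IsResolvent A l R := by
  have hinj : Function.Injective (shifted A l) := by
    refine (injective_iff_map_eq_zero _).2 fun x hx => ?_
    have hle := hA.norm_le hN hl x
    rw [hx, norm_zero, mul_zero, norm_le_zero_iff] at hle
    exact Subtype.ext hle
  let e := LinearEquiv.ofBijective (shifted A l) ⟨hinj, hs⟩
  refine ⟨(A.domain.subtype ∘ₗ e.symm.toLinearMap).mkContinuous l⁻¹ fun y => ?_, hs, fun x => ?_⟩
  · exact (hA.norm_le hN hl (e.symm y)).trans_eq (congrArg (l⁻¹ * ‖·‖) (e.apply_symm_apply y))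
  · exact congrArg Subtype.val (e.symm_apply_apply x)

theorem surjective_one_sub [CompleteSpace X] (hS : ‖S‖ < 1) :
    Function.Surjective (1 - S : X →L[𝕜] X) := by
  intro y
  have hinv : (1 - S) * ↑(Units.oneSub S hS)⁻¹ = 1 := (Units.oneSub S hS).mul_inv
  exact ⟨_, congrArg (fun f : X →L[𝕜] X => f y) hinv⟩

/-- With `R = (l - A)⁻¹`, one has `m - A = (1 - (l - m) R) (l - A)`, and the first factor is
invertible by the Neumann series. -/
theorem IsDissipativeFor.surjective_shifted_of_lt [CompleteSpace X] (hA : IsDissipativeFor Γ A)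
    (hN : IsNorming Γ) (hl : 0 < l) (hs : Function.Surjective (shifted A l)) (hm : 0 < m)
    (hml : m < 2 * l) : Function.Surjective (shifted A m) := by
  obtain ⟨R, hR⟩ := hA.exists_isResolvent hN hl hs
  have hsmall : ‖((l - m : ℝ) : 𝕜) • R‖ < 1 := by
    rw [norm_smul, RCLike.norm_ofReal]
    calc |l - m| * ‖R‖ ≤ |l - m| * l⁻¹ := by gcongr; exact hR.norm_le hA hN hl
      _ < l * l⁻¹ := by
        have : |l - m| < l := abs_lt.2 ⟨by linarith, by linarith⟩
        gcongr
      _ = 1 := mul_inv_cancel₀ hl.ne'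
  intro y
  obtain ⟨z, rfl⟩ := surjective_one_sub hsmall y
  obtain ⟨x, rfl⟩ := hs z
  refine ⟨x, ?_⟩
  change shifted A m x = shifted A l x - ((l - m : ℝ) : 𝕜) • R (shifted A l x)
  rw [hR.left_inv, shifted_eq_add A l m x, RCLike.ofReal_sub, RCLike.ofReal_sub]
  module

theorem IsDissipativeFor.surjective_shifted [CompleteSpace X] (hA : IsDissipativeFor Γ A)
    (hN : IsNorming Γ) (hl : 0 < l) (hs : Function.Surjective (shifted A l)) (hm : 0 < m) :
    Function.Surjective (shifted A m) := by
  have hpow : ∀ n : ℕ, Function.Surjective (shifted A (l * (3 / 2) ^ n)) := by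
    intro n
    induction n with
    | zero => simpa using hs
    | succ n ih =>
      have : 0 < l * (3 / 2) ^ n := by positivity
      exact hA.surjective_shifted_of_lt hN this ih (by positivity) (by rw [pow_succ]; linarith)
  obtain ⟨n, hn⟩ := pow_unbounded_of_one_lt (m / l) (by norm_num : (1 : ℝ) < 3 / 2)
  rw [div_lt_iff₀ hl] at hn
  exact hA.surjective_shifted_of_lt hN (by positivity) (hpow n) hm (by linarith)

theorem IsResolvent.seminorm_smul_sub_le (hR : IsResolvent A l R) (hA : IsDissipativeFor Γ A)
    (hl : 0 < l) {p : Seminorm 𝕜 X} (hp : p ∈ Γ) (y : X) (v : A.domain) :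
    p ((l : 𝕜) • R y - y) ≤ 2 * p (v - y) + l⁻¹ * p (A v) := by
  have hsplit : (l : 𝕜) • R y - y = R (A v) + (v - y) - (l : 𝕜) • R (v - y) := by
    rw [← hR.smul_apply_sub v, map_sub, smul_sub]
    abel
  have hRA : p (R (A v)) ≤ l⁻¹ * p (A v) := by
    rw [inv_mul_eq_div, le_div_iff₀' hl]
    exact hR.seminorm_le hA hl hp _
  rw [hsplit]
  linarith [map_sub_le_add p (R (A v) + (v - y)) ((l : 𝕜) • R (v - y)),
    map_add_le_add p (R (A v)) (v - y), hR.seminorm_smul_le hA hl hp (v - y)]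

theorem seminormTendsto_smul_resolvent (hA : IsDissipativeFor Γ A)
    (hD : IsSeminormDense Γ (A.domain : Set X)) {r : ℕ → ℝ} (hr : ∀ n, 0 < r n)
    (hr' : Tendsto r atTop atTop) {R : ℕ → X →L[𝕜] X} (hR : ∀ n, IsResolvent A (r n) (R n))
    (y : X) : SeminormTendsto Γ (fun n => (r n : 𝕜) • R n y) atTop y := fun _ hp =>
  hD.tendsto_zero hp y (fun _ => apply_nonneg _ _)
    (fun v => by simpa using hr'.inv_tendsto_atTop.mul_const _)
    fun v => .of_forall fun n => (hR n).seminorm_smul_sub_le hA (hr n) hp y v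

end Resolvent

/-! ### Groups generated by bounded operators -/

section ExpGroup

variable {p : Seminorm 𝕜 X} {B C K : X →L[𝕜] X}

/-- The group `z ↦ exp (z B)` generated by a bounded operator `B`. -/
noncomputable def expGroup (B : X →L[𝕜] X) (z : 𝕜) : X →L[𝕜] X :=
  NormedSpace.exp (z • B)

@[simp]
theorem expGroup_zero (B : X →L[𝕜] X) : expGroup B 0 = 1 := by
  rw [expGroup, zero_smul, NormedSpace.exp_zero]

theorem commute_expGroup_left (h : Commute B C) (z : 𝕜) : Commute (expGroup B z) C :=
  (h.smul_left z).exp_left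

theorem exp_ofReal_smul_one (a : ℝ) :
    NormedSpace.exp ((a : 𝕜) • (1 : X →L[𝕜] X)) = ((Real.exp a : ℝ) : 𝕜) • 1 := by
  have hscalar : ((Real.exp a : ℝ) : 𝕜) = NormedSpace.exp (a : 𝕜) := by
    rw [Real.exp_eq_exp_ℝ]
    exact NormedSpace.algebraMap_exp_comm (𝕂 := ℝ) (𝔸 := 𝕜) a
  rw [hscalar, ← Algebra.algebraMap_eq_smul_one, ← Algebra.algebraMap_eq_smul_one,
    NormedSpace.algebraMap_exp_comm]

theorem seminorm_image_sub_le_of_hasDerivAt (hp : ∀ x, p x ≤ ‖x‖) {f f' : 𝕜 → X}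
    (hf : ∀ z, HasDerivAt f (f' z) z) {t c : ℝ} (ht : 0 ≤ t)
    (hbound : ∀ s : ℝ, 0 ≤ s → s ≤ t → p (f' s) ≤ c) : p (f t - f 0) ≤ t * c := by
  obtain ⟨φ, hφ, hφp⟩ := exists_functional_eq_seminorm p (f t - f 0)
  let ψ : X →L[𝕜] 𝕜 := φ.mkContinuous 1 fun x => by simpa using (hφp x).trans (hp x)
  have hderiv (s : ℝ) : HasDerivAt (fun s : ℝ => φ (f s)) (φ (f' s)) s := by
    have hψ : HasDerivAt (ψ ∘ f) (ψ (f' s)) (s : 𝕜) := ψ.hasFDerivAt.comp_hasDerivAt _ (hf s)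
    have hofReal : HasDerivAt ((↑) : ℝ → 𝕜) (1 : ℝ) s :=
      (RCLike.ofRealCLM (K := 𝕜)).hasDerivAt (x := s)
    have hcomp := hψ.scomp s hofReal
    rwa [RCLike.ofReal_one, one_smul] at hcomp
  have hmvt := norm_image_sub_le_of_norm_deriv_le_segment'
    (fun s _ => (hderiv s).hasDerivWithinAt) (fun s hs => (hφp _).trans (hbound s hs.1 hs.2.le))
    t (Set.right_mem_Icc.2 ht)
  rwa [RCLike.ofReal_zero, ← map_sub, hφ, sub_zero, mul_comm] at hmvt

variable [CompleteSpace X]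

theorem expGroup_add (B : X →L[𝕜] X) (z w : 𝕜) :
    expGroup B (z + w) = expGroup B z * expGroup B w := by
  let _ := NormedAlgebra.restrictScalars ℚ 𝕜 (X →L[𝕜] X)
  rw [expGroup, add_smul,
    NormedSpace.exp_add_of_commute (((Commute.refl B).smul_left _).smul_right _), expGroup,
    expGroup]

theorem hasDerivAt_expGroup (B : X →L[𝕜] X) (z : 𝕜) :
    HasDerivAt (expGroup B) (expGroup B z * B) z :=
  hasDerivAt_exp_smul_const B z

theorem hasDerivAt_expGroup_apply (B : X →L[𝕜] X) (x : X) (z : 𝕜) :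
    HasDerivAt (fun z => expGroup B z x) (expGroup B z (B x)) z := by
  simpa using (hasDerivAt_expGroup B z).clm_apply (hasDerivAt_const z x)

theorem seminorm_expGroup_le (hp : ∀ x, p x ≤ ‖x‖) (hK : ∀ x, p (K x) ≤ p x) {c : ℝ}
    (hc : 0 ≤ c) (x : X) : p (expGroup K c x) ≤ Real.exp c * p x := by
  have hpow (n : ℕ) : p ((K ^ n) x) ≤ p x := by
    induction n with
    | zero => rfl
    | succ n ih => rw [pow_succ']; exact (hK _).trans ih
  have hcont : Continuous p :=
    Seminorm.continuous_of_le (q := normSeminorm 𝕜 X) continuous_norm hp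
  have hseries := (ContinuousLinearMap.apply 𝕜 X x).hasSum <|
    NormedSpace.exp_series_hasSum_exp' (𝕂 := 𝕜) ((c : 𝕜) • K)
  refine le_of_tendsto ((hcont.tendsto _).comp hseries.tendsto_sum_nat) (.of_forall fun n => ?_)
  calc p (∑ i ∈ Finset.range n,
        ContinuousLinearMap.apply 𝕜 X x ((i.factorial : 𝕜)⁻¹ • ((c : 𝕜) • K) ^ i))
      ≤ ∑ i ∈ Finset.range n,
        p (ContinuousLinearMap.apply 𝕜 X x ((i.factorial : 𝕜)⁻¹ • ((c : 𝕜) • K) ^ i)) :=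
        Finset.le_sum_of_subadditive p (map_zero p).le (map_add_le_add p) _ _
    _ ≤ ∑ i ∈ Finset.range n, c ^ i / i.factorial * p x := by
        refine Finset.sum_le_sum fun i _ => ?_
        rw [ContinuousLinearMap.apply_apply, smul_pow, smul_smul, smul_apply, map_smul_eq_mul,
          norm_mul, norm_inv, norm_pow, RCLike.norm_ofReal, RCLike.norm_natCast,
          abs_of_nonneg hc, ← div_eq_inv_mul]
        exact mul_le_mul_of_nonneg_left (hpow i) (by positivity)
    _ = (∑ i ∈ Finset.range n, c ^ i / i.factorial) * p x := (Finset.sum_mul _ _ _).symm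
    _ ≤ Real.exp c * p x :=
        mul_le_mul_of_nonneg_right (Real.sum_le_exp_of_nonneg hc n) (apply_nonneg p x)

/-- Here `exp (t a (K - 1)) = e ^ (-t a) exp (t a K)`. -/
theorem seminorm_expGroup_smul_sub_one_le (hp : ∀ x, p x ≤ ‖x‖) (hK : ∀ x, p (K x) ≤ p x)
    {a t : ℝ} (ha : 0 ≤ a) (ht : 0 ≤ t) (x : X) :
    p (expGroup ((a : 𝕜) • (K - 1)) (t : 𝕜) x) ≤ p x := by
  let _ := NormedAlgebra.restrictScalars ℚ 𝕜 (X →L[𝕜] X)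
  have hsplit : (t : 𝕜) • (a : 𝕜) • (K - 1) =
      ((-(t * a) : ℝ) : 𝕜) • (1 : X →L[𝕜] X) + ((t * a : ℝ) : 𝕜) • K := by
    push_cast
    module
  rw [expGroup, hsplit, NormedSpace.exp_add_of_commute ((Commute.one_left _).smul_left _),
    exp_ofReal_smul_one, smul_one_mul, smul_apply, map_smul_eq_mul, RCLike.norm_ofReal,
    abs_of_pos (Real.exp_pos _)]
  calc Real.exp (-(t * a)) * p (expGroup K ((t * a : ℝ) : 𝕜) x)
      ≤ Real.exp (-(t * a)) * (Real.exp (t * a) * p x) := by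
        gcongr
        exact seminorm_expGroup_le hp hK (mul_nonneg ht ha) x
    _ = p x := by rw [← mul_assoc, ← Real.exp_add, neg_add_cancel, Real.exp_zero, one_mul]

theorem seminorm_expGroup_sub_sub_le (hp : ∀ x, p x ≤ ‖x‖) {t ε : ℝ} (ht : 0 ≤ t) (x : X)
    (h : ∀ s : ℝ, 0 ≤ s → s ≤ t → p (expGroup B (s : 𝕜) (B x) - B x) ≤ ε) :
    p (expGroup B (t : 𝕜) x - x - (t : 𝕜) • B x) ≤ t * ε := by
  have hderiv (z : 𝕜) : HasDerivAt (fun z => expGroup B z x - z • B x)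
      (expGroup B z (B x) - B x) z := by
    simpa only [one_smul, id] using
      (hasDerivAt_expGroup_apply B x z).fun_sub ((hasDerivAt_id z).smul_const (B x))
  have hmvt := seminorm_image_sub_le_of_hasDerivAt hp hderiv ht h
  simpa [sub_right_comm] using hmvt

theorem seminorm_expGroup_sub_le (hp : ∀ x, p x ≤ ‖x‖)
    (hB : ∀ s : ℝ, 0 ≤ s → ∀ x, p (expGroup B (s : 𝕜) x) ≤ p x) {t : ℝ} (ht : 0 ≤ t) (x : X) :
    p (expGroup B (t : 𝕜) x - x) ≤ t * p (B x) := by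
  have hmvt := seminorm_image_sub_le_of_hasDerivAt hp (hasDerivAt_expGroup_apply B x) ht
    fun s hs _ => hB s hs (B x)
  simpa using hmvt

/-- The curve `s ↦ exp ((t - s) C) exp (s B) x` joins `exp (t C) x` to `exp (t B) x`. -/
theorem seminorm_expGroup_sub_expGroup_le (hp : ∀ x, p x ≤ ‖x‖)
    (hB : ∀ s : ℝ, 0 ≤ s → ∀ x, p (expGroup B (s : 𝕜) x) ≤ p x)
    (hC : ∀ s : ℝ, 0 ≤ s → ∀ x, p (expGroup C (s : 𝕜) x) ≤ p x) (hBC : Commute B C) {t : ℝ}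
    (ht : 0 ≤ t) (x : X) :
    p (expGroup B (t : 𝕜) x - expGroup C (t : 𝕜) x) ≤ t * p (B x - C x) := by
  have hderiv (z : 𝕜) : HasDerivAt (fun z => expGroup C (t - z) (expGroup B z x))
      (expGroup C (t - z) (expGroup B z (B x - C x))) z := by
    have hcomm : C (expGroup B z x) = expGroup B z (C x) :=
      (DFunLike.congr_fun (commute_expGroup_left hBC z) x).symm
    have hCz := (hasDerivAt_expGroup C (t - z)).comp_const_sub (t : 𝕜) z
    convert hCz.clm_apply (hasDerivAt_expGroup_apply B x z) using 1
    rw [map_sub, map_sub, ← hcomm, sub_eq_neg_add]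
    rfl
  have hmvt := seminorm_image_sub_le_of_hasDerivAt hp hderiv ht fun s hs hst => by
    have hts := hC (t - s) (sub_nonneg.2 hst) (expGroup B (s : 𝕜) (B x - C x))
    rw [RCLike.ofReal_sub] at hts
    exact hts.trans (hB s hs _)
  simpa using hmvt

end ExpGroup

/-! ### The semigroup as a limit of Yosida approximations -/

section Yosida

variable {Γ : Set (Seminorm 𝕜 X)} {A : X →ₗ.[𝕜] X} {B : ℕ → X →L[𝕜] X} {T : NNReal → X →L[𝕜] X}

/-- The Yosida approximation `r (r R - 1) = r A R` of `A`, where `R = (r - A)⁻¹`. -/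
def yosida (r : ℝ) (R : X →L[𝕜] X) : X →L[𝕜] X :=
  (r : 𝕜) • ((r : 𝕜) • R - 1)

/-- The bounded operators `B n` commute, approximate `A` on its domain, and generate groups that
are contractive in positive time for every seminorm in `Γ`. -/
structure IsContractiveApproximation (Γ : Set (Seminorm 𝕜 X)) (A : X →ₗ.[𝕜] X)
    (B : ℕ → X →L[𝕜] X) : Prop where
  commute : ∀ m n, Commute (B m) (B n)
  contractive : ∀ n, ∀ p ∈ Γ, ∀ t : ℝ, 0 ≤ t → ∀ x, p (expGroup (B n) (t : 𝕜) x) ≤ p x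
  tendsto : ∀ x : A.domain, SeminormTendsto Γ (fun n => B n x) atTop (A x)

/-- `T` is the limit of the groups generated by the operators `B n`. -/
def IsExpLimit (Γ : Set (Seminorm 𝕜 X)) (B : ℕ → X →L[𝕜] X) (T : NNReal → X →L[𝕜] X) : Prop :=
  ∀ (t : NNReal) x, SeminormTendsto Γ (fun n => expGroup (B n) ((t : ℝ) : 𝕜) x) atTop (T t x)

theorem IsResolvent.commute_yosida {l m : ℝ} {R S : X →L[𝕜] X} (hR : IsResolvent A l R)
    (hS : IsResolvent A m S) : Commute (yosida l R) (yosida m S) := by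
  have h : Commute ((l : 𝕜) • R) ((m : 𝕜) • S) := ((hR.commute hS).smul_left _).smul_right _
  exact ((((h.sub_left (Commute.one_left _)).sub_right (Commute.one_right _))).smul_left
    _).smul_right _

theorem IsDissipativeFor.exists_isContractiveApproximation [CompleteSpace X]
    (hA : IsDissipativeFor Γ A) (hN : IsNorming Γ) (hD : IsSeminormDense Γ (A.domain : Set X))
    {l : ℝ} (hl : 0 < l) (hs : Function.Surjective (shifted A l)) :
    ∃ B : ℕ → X →L[𝕜] X, IsContractiveApproximation Γ A B := by
  let r (n : ℕ) : ℝ := n + 1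
  have hr (n : ℕ) : 0 < r n := n.cast_add_one_pos
  have hr' : Tendsto r atTop atTop :=
    tendsto_atTop_add_const_right _ _ tendsto_natCast_atTop_atTop
  choose R hR using fun n =>
    hA.exists_isResolvent hN (hr n) (hA.surjective_shifted hN hl hs (hr n))
  refine ⟨fun n => yosida (r n) (R n), fun m n => (hR m).commute_yosida (hR n),
    fun n p hp t ht x => ?_, fun x => ?_⟩
  · exact seminorm_expGroup_smul_sub_one_le (hN.le_norm hp)
      ((hR n).seminorm_smul_le hA (hr n) hp) (hr n).le ht x
  · have happly (n : ℕ) : yosida (r n) (R n) x = (r n : 𝕜) • R n (A x) := by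
      rw [← (hR n).smul_apply_sub x]
      rfl
    simpa only [happly] using seminormTendsto_smul_resolvent hA hD hr hr' hR (A x)

namespace IsContractiveApproximation

variable [CompleteSpace X]

theorem exists_seminormTendsto_expGroup (hB : IsContractiveApproximation Γ A B)
    (hN : IsNorming Γ) (hc : IsBoundedlyComplete Γ) (hD : IsSeminormDense Γ (A.domain : Set X))
    {t : ℝ} (ht : 0 ≤ t) (x : X) :
    ∃ y, SeminormTendsto Γ (fun n => expGroup (B n) (t : 𝕜) x) atTop y := by
  refine hc _ ⟨‖x‖, fun n => hN.norm_le fun p hp =>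
    (hB.contractive n p hp t ht x).trans (hN.le_norm hp x)⟩ fun p hp => ?_
  refine hD.tendsto_zero hp x (fun _ => apply_nonneg _ _)
    (G := fun v mn => t * p (B mn.1 v - B mn.2 v))
    (fun v => by simpa using ((hB.tendsto v).cauchy hp).const_mul t)
    fun v => .of_forall fun ⟨m, n⟩ => ?_
  have hsplit : expGroup (B m) (t : 𝕜) x - expGroup (B n) (t : 𝕜) x =
      (expGroup (B m) (t : 𝕜) v - expGroup (B n) (t : 𝕜) v) -
        (expGroup (B m) (t : 𝕜) (v - x) - expGroup (B n) (t : 𝕜) (v - x)) := by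
    simp only [map_sub]
    abel
  change p (expGroup (B m) (t : 𝕜) x - expGroup (B n) (t : 𝕜) x) ≤ _
  rw [hsplit]
  linarith [map_sub_le_add p (expGroup (B m) (t : 𝕜) v - expGroup (B n) (t : 𝕜) v)
      (expGroup (B m) (t : 𝕜) (v - x) - expGroup (B n) (t : 𝕜) (v - x)),
    map_sub_le_add p (expGroup (B m) (t : 𝕜) (v - x)) (expGroup (B n) (t : 𝕜) (v - x)),
    hB.contractive m p hp t ht (v - x), hB.contractive n p hp t ht (v - x),
    seminorm_expGroup_sub_expGroup_le (hN.le_norm hp) (hB.contractive m p hp)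
      (hB.contractive n p hp) (hB.commute m n) ht (v : X)]

theorem exists_isExpLimit (hB : IsContractiveApproximation Γ A B) (hN : IsNorming Γ)
    (hc : IsBoundedlyComplete Γ) (hD : IsSeminormDense Γ (A.domain : Set X)) :
    ∃ T : NNReal → X →L[𝕜] X, IsExpLimit Γ B T := by
  choose T hT using fun (t : NNReal) => hB.exists_seminormTendsto_expGroup hN hc hD t.2
  refine ⟨fun t => LinearMap.mkContinuous
    { toFun := T t
      map_add' := fun x y => (hT t (x + y)).unique hN ?_
      map_smul' := fun c x => (hT t (c • x)).unique hN ?_ } 1 fun x => ?_, hT⟩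
  · simpa only [map_add] using (hT t x).add (hT t y)
  · simpa only [map_smul, RingHom.id_apply] using (hT t x).smul (tendsto_const_nhds (x := c))
  · rw [one_mul]
    refine hN.norm_le fun p hp => le_of_tendsto ((hT t x).tendsto_seminorm hp) ?_
    exact .of_forall fun n => (hB.contractive n p hp t t.2 x).trans (hN.le_norm hp x)

end IsContractiveApproximation

/-- `T` is a semigroup of operators that are contractive for every seminorm in `Γ`. -/
structure IsContractionSemigroupFor (Γ : Set (Seminorm 𝕜 X)) (T : NNReal → X →L[𝕜] X) :
    Prop where
  map_zero : T 0 = ContinuousLinearMap.id 𝕜 X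
  map_add : ∀ t s, T (t + s) = (T t).comp (T s)
  contractive : ∀ p ∈ Γ, ∀ t x, p (T t x) ≤ p x

/-- The difference quotient `(T(t)x - x) / t` tends to `y` as `t ↓ 0`, for every seminorm
in `Γ`. -/
def HasSeminormDerivAtZero (Γ : Set (Seminorm 𝕜 X)) (T : NNReal → X →L[𝕜] X) (x y : X) : Prop :=
  SeminormTendsto Γ (fun t : NNReal => ((t : ℝ) : 𝕜)⁻¹ • (T t x - x)) (𝓝[>] 0) y

theorem IsFundamentalSystem.hasTauDerivAtZero_iff {τ : AuxTopology X}
    (hΓ : IsFundamentalSystem τ Γ) (hτ : @PolynormableSpace 𝕜 X _ _ _ τ.top) {x y : X} :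
    HasTauDerivAtZero τ T x y ↔ HasSeminormDerivAtZero Γ T x y :=
  hΓ.tendsto_nhds_iff hτ

namespace IsExpLimit

variable [CompleteSpace X]

theorem isContractionSemigroupFor (hT : IsExpLimit Γ B T)
    (hB : IsContractiveApproximation Γ A B) (hN : IsNorming Γ) :
    IsContractionSemigroupFor Γ T where
  map_zero := by
    ext x
    exact (hT 0 x).unique hN (by simpa using SeminormTendsto.const x)
  map_add t s := by
    ext x
    refine (hT (t + s) x).unique hN fun p hp => ?_
    have hsum := (hT s x p hp).add (hT t (T s x) p hp)
    rw [add_zero] at hsum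
    refine squeeze_zero (fun _ => apply_nonneg p _) (fun n => ?_) hsum
    have hsplit : expGroup (B n) (((t + s : NNReal) : ℝ) : 𝕜) x - T t (T s x) =
        expGroup (B n) ((t : ℝ) : 𝕜) (expGroup (B n) ((s : ℝ) : 𝕜) x - T s x) +
          (expGroup (B n) ((t : ℝ) : 𝕜) (T s x) - T t (T s x)) := by
      rw [NNReal.coe_add, RCLike.ofReal_add, expGroup_add, map_sub, sub_add_sub_cancel]
      rfl
    change p (expGroup (B n) (((t + s : NNReal) : ℝ) : 𝕜) x - T t (T s x)) ≤ _
    rw [hsplit]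
    exact (map_add_le_add p _ _).trans
      (add_le_add_left (hB.contractive n p hp t t.2 _) _)
  contractive p hp t x := le_of_tendsto ((hT t x).tendsto_seminorm hp)
    (.of_forall fun n => hB.contractive n p hp t t.2 x)

theorem seminorm_sub_le (hT : IsExpLimit Γ B T) (hB : IsContractiveApproximation Γ A B)
    (hN : IsNorming Γ) {p : Seminorm 𝕜 X} (hp : p ∈ Γ) (t : NNReal) (x : A.domain) :
    p (T t x - x) ≤ t * p (A x) :=
  le_of_tendsto_of_tendsto (((hT t x).sub (.const (x : X))).tendsto_seminorm hp)
    (((hB.tendsto x).tendsto_seminorm hp).const_mul (t : ℝ))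
    (.of_forall fun n => seminorm_expGroup_sub_le (hN.le_norm hp) (hB.contractive n p hp) t.2 x)

theorem seminorm_sub_sub_le (hT : IsExpLimit Γ B T) (hB : IsContractiveApproximation Γ A B)
    (hN : IsNorming Γ) {p : Seminorm 𝕜 X} (hp : p ∈ Γ) (t : NNReal) (x v : A.domain) :
    p (T t x - x - ((t : ℝ) : 𝕜) • A x) ≤ t * (2 * p (v - A x) + t * p (A v)) := by
  have hleft := (((hT t x).sub (.const (x : X))).sub
    ((hB.tendsto x).smul (tendsto_const_nhds (x := ((t : ℝ) : 𝕜))))).tendsto_seminorm hp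
  have hright := ((((SeminormTendsto.const (v : X)).sub (hB.tendsto x)).tendsto_seminorm
    hp).const_mul 2 |>.add (((hB.tendsto v).tendsto_seminorm hp).const_mul (t : ℝ))).const_mul
    (t : ℝ)
  refine le_of_tendsto_of_tendsto hleft hright (.of_forall fun n => ?_)
  refine seminorm_expGroup_sub_sub_le (hN.le_norm hp) t.2 x fun s hs hst => ?_
  have hsplit : expGroup (B n) (s : 𝕜) (B n x) - B n x =
      (expGroup (B n) (s : 𝕜) v - v) - (expGroup (B n) (s : 𝕜) (v - B n x) - (v - B n x)) := by
    rw [map_sub]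
    abel
  have hv : p (expGroup (B n) (s : 𝕜) v - v) ≤ t * p (B n v) :=
    (seminorm_expGroup_sub_le (hN.le_norm hp) (hB.contractive n p hp) hs (v : X)).trans
      (mul_le_mul_of_nonneg_right hst (apply_nonneg p _))
  rw [hsplit]
  linarith [map_sub_le_add p (expGroup (B n) (s : 𝕜) v - v)
      (expGroup (B n) (s : 𝕜) (v - B n x) - (v - B n x)),
    map_sub_le_add p (expGroup (B n) (s : 𝕜) (v - B n x)) (v - B n x),
    hB.contractive n p hp s hs (v - B n x)]

theorem hasSeminormDerivAtZero (hT : IsExpLimit Γ B T) (hB : IsContractiveApproximation Γ A B)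
    (hN : IsNorming Γ) (hD : IsSeminormDense Γ (A.domain : Set X)) (x : A.domain) :
    HasSeminormDerivAtZero Γ T x (A x) := by
  intro p hp
  refine hD.tendsto_zero hp (A x) (fun _ => apply_nonneg _ _)
    (G := fun v t => t * p (A v)) (fun v => ?_) fun v => ?_
  · simpa using ((NNReal.continuous_coe.tendsto 0).mono_left nhdsWithin_le_nhds).mul_const
      (p (A v))
  · filter_upwards [self_mem_nhdsWithin] with t ht
    exact seminorm_inv_smul_sub_le ht (hT.seminorm_sub_sub_le hB hN hp t x v)

end IsExpLimit

theorem IsDissipativeFor.exists_contractionSemigroup [CompleteSpace X]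
    (hA : IsDissipativeFor Γ A) (hN : IsNorming Γ) (hc : IsBoundedlyComplete Γ)
    (hD : IsSeminormDense Γ (A.domain : Set X)) {l : ℝ} (hl : 0 < l)
    (hs : Function.Surjective (shifted A l)) :
    ∃ T : NNReal → X →L[𝕜] X, IsContractionSemigroupFor Γ T ∧
      (∀ p ∈ Γ, ∀ (t : NNReal) (x : A.domain), p (T t x - x) ≤ t * p (A x)) ∧
      ∀ x : A.domain, HasSeminormDerivAtZero Γ T x (A x) := by
  obtain ⟨B, hB⟩ := hA.exists_isContractiveApproximation hN hD hl hs
  obtain ⟨T, hT⟩ := hB.exists_isExpLimit hN hc hD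
  exact ⟨T, hT.isContractionSemigroupFor hB hN, fun p hp => hT.seminorm_sub_le hB hN hp,
    hT.hasSeminormDerivAtZero hB hN hD⟩

end Yosida

/-! ### Generation of contraction semigroups -/

section Generation

variable {τ : AuxTopology X} {Γ : Set (Seminorm 𝕜 X)} {A : X →ₗ.[𝕜] X} {T : NNReal → X →L[𝕜] X}

theorem HasSeminormDerivAtZero.sub {x y v w : X} (hx : HasSeminormDerivAtZero Γ T x y)
    (hv : HasSeminormDerivAtZero Γ T v w) : HasSeminormDerivAtZero Γ T (x - v) (y - w) := by
  have hsub := SeminormTendsto.sub hx hv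
  simp only [← smul_sub] at hsub
  unfold HasSeminormDerivAtZero
  simpa only [map_sub, sub_sub_sub_comm] using hsub

namespace IsContractionSemigroupFor

theorem norm_le_one (hT : IsContractionSemigroupFor Γ T) (hN : IsNorming Γ) (t : NNReal) :
    ‖T t‖ ≤ 1 := by
  refine (T t).opNorm_le_bound zero_le_one fun x => ?_
  rw [one_mul]
  exact hN.norm_le fun p hp => (hT.contractive p hp t x).trans (hN.le_norm hp x)

theorem seminorm_sub_le (hT : IsContractionSemigroupFor Γ T) {p : Seminorm 𝕜 X} (hp : p ∈ Γ)
    (s t : NNReal) (x : X) : p (T s x - T t x) ≤ p (T (nndist s t) x - x) := by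
  wlog hts : t ≤ s generalizing s t
  · rw [map_sub_rev, nndist_comm]
    exact this t s (le_of_not_ge hts)
  have hs : T s x - T t x = T t (T (s - t) x - x) := by
    rw [map_sub, ← ContinuousLinearMap.comp_apply, ← hT.map_add, add_tsub_cancel_of_le hts]
  rw [hs, NNReal.nndist_eq, max_eq_left (by simp [tsub_eq_zero_of_le hts])]
  exact hT.contractive p hp t _

theorem seminormContinuous (hT : IsContractionSemigroupFor Γ T)
    (hD : IsSeminormDense Γ (A.domain : Set X))
    (hA : ∀ p ∈ Γ, ∀ (t : NNReal) (x : A.domain), p (T t x - x) ≤ t * p (A x)) (x : X) :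
    SeminormContinuous Γ (fun t => T t x) := by
  intro t p hp
  refine hD.tendsto_zero hp x (fun _ => apply_nonneg p _) (G := fun v s => dist s t * p (A v))
    (fun v => ?_) fun v => .of_forall fun s => ?_
  · simpa using (tendsto_iff_dist_tendsto_zero.1 (tendsto_id (x := 𝓝 t))).mul_const (p (A v))
  · have hsplit : T s x - T t x = (T s v - T t v) - (T s (v - x) - T t (v - x)) := by
      simp only [map_sub]
      abel
    have hv : p (T s v - T t v) ≤ dist s t * p (A v) :=
      (hT.seminorm_sub_le hp s t (v : X)).trans (hA p hp (nndist s t) v)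
    rw [hsplit]
    linarith [map_sub_le_add p (T s v - T t v) (T s (v - x) - T t (v - x)),
      map_sub_le_add p (T s (v - x)) (T t (v - x)), hT.contractive p hp s (v - x),
      hT.contractive p hp t (v - x)]

theorem isBiContinuousSemigroup (hT : IsContractionSemigroupFor Γ T)
    (hΓ : IsFundamentalSystem τ Γ) (hτ : @PolynormableSpace 𝕜 X _ _ _ τ.top)
    (hN : IsNorming Γ) (hcont : ∀ x, SeminormContinuous Γ (fun t => T t x)) :
    IsBiContinuousSemigroup τ T where
  map_add := hT.map_add
  map_zero := hT.map_zero
  stronglyContinuous x := (@continuous_iff_continuousAt _ _ _ τ.top _).2 fun t =>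
    (hΓ.tendsto_nhds_iff hτ).2 (hcont x t)
  exponentiallyBounded := ⟨1, 0, le_rfl, fun t => by simpa using hT.norm_le_one hN t⟩
  locallyBiEquicontinuous u _ hu t₀ U hU := by
    obtain ⟨p, hp, ε, hε, hsub⟩ := hΓ.exists_ball_subset U hU
    filter_upwards [((hΓ.tendsto_nhds_iff hτ).1 hu p hp).eventually_lt_const hε] with n hn s _
    rw [sub_zero] at hn
    exact hsub ((hT.contractive p hp s (u n)).trans_lt hn)

/-- The generator is dissipative, so it has no positive eigenvalue. -/
theorem eq_zero_of_hasSeminormDerivAtZero (hT : IsContractionSemigroupFor Γ T)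
    (hN : IsNorming Γ) {l : ℝ} (hl : 0 < l) {x : X}
    (hx : HasSeminormDerivAtZero Γ T x ((l : 𝕜) • x)) : x = 0 := by
  rw [← norm_le_zero_iff]
  refine hN.norm_le fun p hp => nonpos_of_mul_nonpos_right ?_ hl
  refine ge_of_tendsto (hx p hp) ?_
  filter_upwards [self_mem_nhdsWithin] with t ht
  have ht : (0 : ℝ) < t := ht
  have ht' : ((t : ℝ) : 𝕜) ≠ 0 := RCLike.ofReal_ne_zero.2 ht.ne'
  have hsplit : ((1 + t * l : ℝ) : 𝕜) • x =
      T t x - ((t : ℝ) : 𝕜) • (((t : ℝ) : 𝕜)⁻¹ • (T t x - x) - (l : 𝕜) • x) := by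
    rw [smul_sub, smul_inv_smul₀ ht']
    push_cast
    module
  have hle := map_sub_le_add p (T t x)
    (((t : ℝ) : 𝕜) • (((t : ℝ) : 𝕜)⁻¹ • (T t x - x) - (l : 𝕜) • x))
  rw [← hsplit, map_smul_eq_mul, map_smul_eq_mul, RCLike.norm_ofReal, RCLike.norm_ofReal,
    abs_of_pos ht, abs_of_pos (by positivity)] at hle
  refine le_of_mul_le_mul_left ?_ ht
  linarith [hT.contractive p hp t x]

theorem mem_domain (hT : IsContractionSemigroupFor Γ T) (hN : IsNorming Γ) {l : ℝ} (hl : 0 < l)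
    (hs : Function.Surjective (shifted A l))
    (hA : ∀ x : A.domain, HasSeminormDerivAtZero Γ T x (A x)) {x y : X}
    (hx : HasSeminormDerivAtZero Γ T x y) : x ∈ A.domain := by
  obtain ⟨u, hu⟩ := hs ((l : 𝕜) • x - y)
  have hsub := hx.sub (hA u)
  have heigen : y - A u = (l : 𝕜) • (x - u) := by
    rw [shifted_apply] at hu
    linear_combination (norm := module) hu
  rw [heigen] at hsub
  rw [sub_eq_zero.1 (hT.eq_zero_of_hasSeminormDerivAtZero hN hl hsub)]
  exact u.2

theorem isGenerator (hT : IsContractionSemigroupFor Γ T) (hΓ : IsFundamentalSystem τ Γ)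
    (hτ : @PolynormableSpace 𝕜 X _ _ _ τ.top) (hN : IsNorming Γ) {l : ℝ} (hl : 0 < l)
    (hs : Function.Surjective (shifted A l))
    (hle : ∀ p ∈ Γ, ∀ (t : NNReal) (x : A.domain), p (T t x - x) ≤ t * p (A x))
    (hA : ∀ x : A.domain, HasSeminormDerivAtZero Γ T x (A x)) : IsGenerator τ T A where
  mem_domain_iff x := by
    refine ⟨fun hx => ⟨⟨A ⟨x, hx⟩, (hΓ.hasTauDerivAtZero_iff hτ).2 (hA ⟨x, hx⟩)⟩,
      ‖A ⟨x, hx⟩‖, fun t ht _ => ?_⟩, fun ⟨⟨_, hy⟩, _⟩ =>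
      hT.mem_domain hN hl hs hA ((hΓ.hasTauDerivAtZero_iff hτ).1 hy)⟩
    rw [div_le_iff₀' (NNReal.coe_pos.2 ht)]
    exact hN.norm_le fun p hp => (hle p hp t ⟨x, hx⟩).trans
      (mul_le_mul_of_nonneg_left (hN.le_norm hp _) t.2)
  hasTauDeriv x := (hΓ.hasTauDerivAtZero_iff hτ).2 (hA x)

end IsContractionSemigroupFor

theorem IsDissipativeFor.generatesContractionSemigroup [CompleteSpace X]
    (hA : IsDissipativeFor Γ A) (hΓ : IsFundamentalSystem τ Γ) (hN : IsNorming Γ)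
    (hτ : IsBiAdmissible 𝕜 τ) (hD : @Dense X τ.top (A.domain : Set X)) {l : ℝ} (hl : 0 < l)
    (hs : Function.Surjective (shifted A l)) : GeneratesContractionSemigroup τ A := by
  have hD' := hΓ.isSeminormDense hτ.locallyConvex hD
  obtain ⟨T, hT, hle, hderiv⟩ :=
    hA.exists_contractionSemigroup hN (hΓ.isBoundedlyComplete hτ) hD' hl hs
  exact ⟨T, hT.isBiContinuousSemigroup hΓ hτ.locallyConvex hN (hT.seminormContinuous hD' hle),
    hT.norm_le_one hN, hT.isGenerator hΓ hτ.locallyConvex hN hl hs hle hderiv⟩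

theorem BiDenselyDefined.dense (hA : BiDenselyDefined τ A) :
    @Dense X τ.top (A.domain : Set X) := by
  intro x
  obtain ⟨u, hu, -, hux⟩ := hA x
  exact @mem_closure_of_tendsto X τ.top _ _ _ _ _ _ hux (.of_forall hu)

end Generation

/-! ### Riemann sums and integrals -/

section Integral

theorem norm_integral_sub_smul_le {F : Type*} [NormedAddCommGroup F] [NormedSpace ℝ F]
    [CompleteSpace F] {g : ℝ → F} {a b ε : ℝ} {c : F} (hab : a ≤ b)
    (hg : IntervalIntegrable g MeasureTheory.volume a b)
    (hε : ∀ s ∈ Set.Icc a b, ‖g s - c‖ ≤ ε) :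
    ‖(∫ x in a..b, g x) - (b - a) • c‖ ≤ (b - a) * ε := by
  rw [← intervalIntegral.integral_const, ← intervalIntegral.integral_sub hg
    intervalIntegrable_const]
  have hle := intervalIntegral.norm_integral_le_of_norm_le_const (f := fun x => g x - c)
    (a := a) (b := b) fun x hx => hε x (Set.uIoc_subset_uIcc.trans_eq (Set.uIcc_of_le hab) hx)
  rwa [abs_of_nonneg (sub_nonneg.2 hab), mul_comm] at hle

variable {E : Type*} [AddCommGroup E] [Module 𝕜 E]

variable (𝕜) in
/-- The left Riemann sum of `f` over `[a, a + h]` for the partition into `n` equal pieces. -/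
noncomputable def riemannSum (f : ℝ → E) (a h : ℝ) (n : ℕ) : E :=
  ((h / n : ℝ) : 𝕜) • ∑ k ∈ Finset.range n, f (a + k * (h / n))

variable {Γ : Set (Seminorm 𝕜 E)} {p : Seminorm 𝕜 E} {φ : E →ₗ[𝕜] 𝕜} {f : ℝ → E} {a b h : ℝ}

theorem add_mul_div_mem_Icc (hh : 0 ≤ h) {n k : ℕ} (hk : k ≤ n) :
    a + k * (h / n) ∈ Set.Icc a (a + h) := by
  have hkn : k * (h / n) ≤ h := by
    rw [mul_div_left_comm]
    exact mul_le_of_le_one_right hh (div_le_one_of_le₀ (by exact_mod_cast hk) n.cast_nonneg)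
  exact ⟨le_add_of_nonneg_right (by positivity), by gcongr⟩

theorem norm_riemannSum_sub_integral_le {g : ℝ → 𝕜} (hg : Continuous g) (hh : 0 ≤ h) {n : ℕ}
    (hn : n ≠ 0) {ε : ℝ} (hε : ∀ s ∈ Set.Icc a (a + h), ∀ t ∈ Set.Icc a (a + h),
      |s - t| ≤ h / n → ‖g s - g t‖ ≤ ε) :
    ‖riemannSum 𝕜 g a h n - ∫ x in a..a + h, g x‖ ≤ h * ε := by
  let c (k : ℕ) : ℝ := a + k * (h / n)
  have hc (k : ℕ) : c (k + 1) - c k = h / n := by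
    simp only [c]
    push_cast
    ring
  have hδ : 0 ≤ h / n := by positivity
  have hnh : (n : ℝ) * (h / n) = h := mul_div_cancel₀ h (by exact_mod_cast hn)
  have hpieces : ∑ k ∈ Finset.range n, ∫ x in c k..c (k + 1), g x = ∫ x in a..a + h, g x := by
    rw [intervalIntegral.sum_integral_adjacent_intervals fun k _ => hg.intervalIntegrable _ _]
    simp only [c, Nat.cast_zero, zero_mul, add_zero, hnh]
  have hpiece (k : ℕ) (hk : k < n) :
      ‖((h / n : ℝ) : 𝕜) • g (c k) - ∫ x in c k..c (k + 1), g x‖ ≤ h / n * ε := by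
    rw [norm_sub_rev, smul_eq_mul, ← RCLike.real_smul_eq_coe_mul, ← hc k]
    have hck := add_mul_div_mem_Icc (a := a) hh hk.le
    have hck' := add_mul_div_mem_Icc (a := a) hh (Nat.succ_le_of_lt hk)
    refine norm_integral_sub_smul_le (by linarith [hc k]) (hg.intervalIntegrable _ _)
      fun s hs => hε s ⟨hck.1.trans hs.1, hs.2.trans hck'.2⟩ _ hck ?_
    rw [abs_of_nonneg (sub_nonneg.2 hs.1), ← hc k]
    exact sub_le_sub_right hs.2 _
  rw [← hpieces, riemannSum, Finset.smul_sum, ← Finset.sum_sub_distrib]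
  calc ‖∑ k ∈ Finset.range n, (((h / n : ℝ) : 𝕜) • g (c k) - ∫ x in c k..c (k + 1), g x)‖
      ≤ ∑ _k ∈ Finset.range n, h / n * ε :=
        norm_sum_le_of_le _ fun k hk => hpiece k (Finset.mem_range.1 hk)
    _ = h * ε := by rw [Finset.sum_const, Finset.card_range, nsmul_eq_mul, ← mul_assoc, hnh]

theorem map_riemannSum (φ : E →ₗ[𝕜] 𝕜) (f : ℝ → E) (a h : ℝ) (n : ℕ) :
    φ (riemannSum 𝕜 f a h n) = riemannSum 𝕜 (fun t => φ (f t)) a h n := by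
  simp only [riemannSum, map_smul, map_sum]

theorem norm_riemannSum_le {f : ℝ → X} (hh : 0 ≤ h) {C : ℝ}
    (hC : ∀ t ∈ Set.Icc a (a + h), ‖f t‖ ≤ C) (n : ℕ) :
    ‖riemannSum 𝕜 f a h n‖ ≤ h * C := by
  have hC0 : 0 ≤ C := (norm_nonneg _).trans (hC a ⟨le_rfl, by linarith⟩)
  rw [riemannSum, norm_smul, RCLike.norm_ofReal, abs_of_nonneg (by positivity)]
  calc h / n * ‖∑ k ∈ Finset.range n, f (a + k * (h / n))‖
      ≤ h / n * ∑ _k ∈ Finset.range n, C := by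
        gcongr
        exact norm_sum_le_of_le _ fun k hk =>
          hC _ (add_mul_div_mem_Icc hh (Finset.mem_range.1 hk).le)
    _ = h / n * n * C := by rw [Finset.sum_const, Finset.card_range, nsmul_eq_mul, mul_assoc]
    _ ≤ h * C := by
        gcongr
        rw [div_mul_comm]
        exact mul_le_of_le_one_left hh (div_self_le_one _)

theorem SeminormContinuous.exists_uniform_modulus (hf : SeminormContinuous Γ f) (hp : p ∈ Γ)
    (a b : ℝ) {ε : ℝ} (hε : 0 < ε) :
    ∃ δ > 0, ∀ s ∈ Set.Icc a b, ∀ t ∈ Set.Icc a b, |s - t| < δ → p (f s - f t) < ε := by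
  have hcont : Continuous fun z : ℝ × ℝ => p (f z.1 - f z.2) := by
    rw [continuous_iff_continuousAt]
    rintro ⟨s, t⟩
    have hfst : SeminormTendsto Γ (fun z : ℝ × ℝ => f z.1) (𝓝 (s, t)) (f s) :=
      fun q hq => (hf s q hq).comp (continuous_fst.tendsto (s, t))
    have hsnd : SeminormTendsto Γ (fun z : ℝ × ℝ => f z.2) (𝓝 (s, t)) (f t) :=
      fun q hq => (hf t q hq).comp (continuous_snd.tendsto (s, t))
    exact (hfst.sub hsnd).tendsto_seminorm hp
  have hunif := (isCompact_Icc.prod isCompact_Icc).uniformContinuousOn_of_continuous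
    (hcont.continuousOn (s := Set.Icc a b ×ˢ Set.Icc a b))
  obtain ⟨δ, hδ, hmod⟩ := Metric.uniformContinuousOn_iff.1 hunif ε hε
  refine ⟨δ, hδ, fun s hs t ht hst => ?_⟩
  have hlt := hmod (s, t) ⟨hs, ht⟩ (t, t) ⟨ht, ht⟩ (by
    rwa [Prod.dist_eq, dist_self, max_eq_left dist_nonneg, Real.dist_eq])
  simpa [Real.dist_eq, abs_of_nonneg (apply_nonneg p _)] using hlt

theorem SeminormTendsto.tendsto_functional {ι : Type*} {l : Filter ι} {u : ι → E} {x : E}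
    (hu : SeminormTendsto Γ u l x) (hp : p ∈ Γ) (hφ : ∀ y, ‖φ y‖ ≤ p y) :
    Tendsto (fun i => φ (u i)) l (𝓝 (φ x)) := by
  rw [tendsto_iff_norm_sub_tendsto_zero]
  refine squeeze_zero (fun _ => norm_nonneg _) (fun i => ?_) (hu p hp)
  rw [← map_sub]
  exact hφ _

theorem SeminormContinuous.continuous_functional (hf : SeminormContinuous Γ f) (hp : p ∈ Γ)
    (hφ : ∀ y, ‖φ y‖ ≤ p y) : Continuous fun t => φ (f t) :=
  continuous_iff_continuousAt.2 fun t => (hf t).tendsto_functional hp hφ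

theorem SeminormContinuous.eventually_norm_map_riemannSum_sub_le (hf : SeminormContinuous Γ f)
    (hp : p ∈ Γ) (a : ℝ) (hh : 0 ≤ h) {ε : ℝ} (hε : 0 < ε) :
    ∀ᶠ n in atTop, ∀ φ : E →ₗ[𝕜] 𝕜, (∀ y, ‖φ y‖ ≤ p y) →
      ‖φ (riemannSum 𝕜 f a h n) - ∫ x in a..a + h, φ (f x)‖ ≤ h * ε := by
  obtain ⟨δ, hδ, hmod⟩ := hf.exists_uniform_modulus hp a (a + h) hε
  filter_upwards [(tendsto_const_div_atTop_nhds_zero_nat h).eventually_lt_const hδ,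
    eventually_ne_atTop 0] with n hn hn0 φ hφ
  rw [map_riemannSum]
  refine norm_riemannSum_sub_integral_le (hf.continuous_functional hp hφ) hh hn0
    fun s hs t ht hst => ?_
  rw [← map_sub]
  exact (hφ _).trans (hmod s hs t ht (hst.trans_lt hn)).le

theorem SeminormContinuous.tendsto_map_riemannSum (hf : SeminormContinuous Γ f) (hp : p ∈ Γ)
    (a : ℝ) (hh : 0 ≤ h) (hφ : ∀ y, ‖φ y‖ ≤ p y) :
    Tendsto (fun n => φ (riemannSum 𝕜 f a h n)) atTop (𝓝 (∫ x in a..a + h, φ (f x))) := by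
  rw [Metric.tendsto_nhds]
  intro ε hε
  have hε' : 0 < ε / (h + 1) := by positivity
  filter_upwards [hf.eventually_norm_map_riemannSum_sub_le hp a hh hε'] with n hn
  rw [dist_eq_norm]
  refine (hn φ hφ).trans_lt ?_
  rw [mul_div_left_comm]
  exact mul_lt_of_lt_one_right hε ((div_lt_one (by positivity)).2 (lt_add_one h))

theorem SeminormContinuous.cauchy_riemannSum (hf : SeminormContinuous Γ f) (hp : p ∈ Γ)
    (a : ℝ) (hh : 0 ≤ h) :
    Tendsto (fun mn : ℕ × ℕ => p (riemannSum 𝕜 f a h mn.1 - riemannSum 𝕜 f a h mn.2)) atTop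
      (𝓝 0) := by
  rw [Metric.tendsto_nhds]
  intro ε hε
  have hε' : 0 < ε / (2 * h + 1) := by positivity
  have hev := hf.eventually_norm_map_riemannSum_sub_le hp a hh hε'
  rw [← prod_atTop_atTop_eq]
  filter_upwards [hev.prod_mk hev] with mn hmn
  obtain ⟨φ, hφ, hφp⟩ :=
    exists_functional_eq_seminorm p (riemannSum 𝕜 f a h mn.1 - riemannSum 𝕜 f a h mn.2)
  rw [Real.dist_eq, sub_zero, abs_of_nonneg (apply_nonneg p _), ← hφ, map_sub,
    ← sub_sub_sub_cancel_right _ _ (∫ x in a..a + h, φ (f x))]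
  calc _ ≤ h * (ε / (2 * h + 1)) + h * (ε / (2 * h + 1)) :=
        (norm_sub_le _ _).trans (add_le_add (hmn.1 φ hφp) (hmn.2 φ hφp))
    _ = ε * (2 * h / (2 * h + 1)) := by ring
    _ < ε := mul_lt_of_lt_one_right hε ((div_lt_one (by positivity)).2 (lt_add_one _))

/-- `J` is the weak integral of `f` over `[a, b]`, tested against the functionals that are
dominated by a seminorm in `Γ`. -/
def IsPettisIntegral (Γ : Set (Seminorm 𝕜 E)) (f : ℝ → E) (a b : ℝ) (J : E) : Prop :=
  ∀ p ∈ Γ, ∀ φ : E →ₗ[𝕜] 𝕜, (∀ y, ‖φ y‖ ≤ p y) → φ J = ∫ x in a..b, φ (f x)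

theorem SeminormContinuous.exists_seminormTendsto_riemannSum {Γ : Set (Seminorm 𝕜 X)}
    {f : ℝ → X} (hf : SeminormContinuous Γ f) (hc : IsBoundedlyComplete Γ) (hh : 0 ≤ h)
    {C : ℝ} (hC : ∀ t ∈ Set.Icc a (a + h), ‖f t‖ ≤ C) :
    ∃ J, SeminormTendsto Γ (riemannSum 𝕜 f a h) atTop J :=
  hc _ ⟨h * C, norm_riemannSum_le hh hC⟩ fun _ hp => hf.cauchy_riemannSum hp a hh

theorem SeminormContinuous.isPettisIntegral (hf : SeminormContinuous Γ f) (hh : 0 ≤ h) {J : E}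
    (hJ : SeminormTendsto Γ (riemannSum 𝕜 f a h) atTop J) :
    IsPettisIntegral Γ f a (a + h) J := fun _ hp _ hφ =>
  tendsto_nhds_unique (hJ.tendsto_functional hp hφ) (hf.tendsto_map_riemannSum hp a hh hφ)

/-- Shifting an interval by `t` adds a piece of length `t` at `b` and removes one at `a`. -/
theorem IsPettisIntegral.seminorm_sub_sub_le {I J u v : E} {t ε ε' : ℝ}
    (hI : IsPettisIntegral Γ f (a + t) (b + t) I) (hJ : IsPettisIntegral Γ f a b J)
    (hf : SeminormContinuous Γ f) (hp : p ∈ Γ) (ht : 0 ≤ t)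
    (hu : ∀ s ∈ Set.Icc b (b + t), p (f s - u) ≤ ε)
    (hv : ∀ s ∈ Set.Icc a (a + t), p (f s - v) ≤ ε') :
    p (I - J - (t : 𝕜) • (u - v)) ≤ t * (ε + ε') := by
  obtain ⟨φ, hφ, hφp⟩ := exists_functional_eq_seminorm p (I - J - (t : 𝕜) • (u - v))
  have hint (s s' : ℝ) : IntervalIntegrable (fun x => φ (f x)) MeasureTheory.volume s s' :=
    (hf.continuous_functional hp hφp).intervalIntegrable _ _
  have hpiece (c : ℝ) (w : E) (η : ℝ) (hw : ∀ s ∈ Set.Icc c (c + t), p (f s - w) ≤ η) :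
      ‖(∫ x in c..c + t, φ (f x)) - t • φ w‖ ≤ t * η := by
    have hle := norm_integral_sub_smul_le (le_add_of_nonneg_right ht) (hint c (c + t))
      (c := φ w) fun s hs => by
        rw [← map_sub]
        exact (hφp _).trans (hw s hs)
    rwa [add_sub_cancel_left] at hle
  have hsplit : φ (I - J - (t : 𝕜) • (u - v)) =
      ((∫ x in b..b + t, φ (f x)) - t • φ u) - ((∫ x in a..a + t, φ (f x)) - t • φ v) := by
    rw [map_sub, map_sub, hI p hp φ hφp, hJ p hp φ hφp,
      intervalIntegral.integral_interval_sub_interval_comm' (hint _ _) (hint _ _) (hint _ _),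
      map_smul, map_sub, smul_eq_mul, ← RCLike.real_smul_eq_coe_mul, smul_sub]
    abel
  rw [← hφ, hsplit, mul_add]
  exact (norm_sub_le _ _).trans (add_le_add (hpiece b u ε hu) (hpiece a v ε' hv))

theorem IsPettisIntegral.tendsto_inv_smul_sub {J : E} {I : NNReal → E}
    (hI : ∀ t : NNReal, IsPettisIntegral Γ f (a + t) (b + t) (I t))
    (hJ : IsPettisIntegral Γ f a b J) (hf : SeminormContinuous Γ f) :
    SeminormTendsto Γ (fun t : NNReal => ((t : ℝ) : 𝕜)⁻¹ • (I t - J)) (𝓝[>] 0)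
      (f b - f a) := by
  intro p hp
  have hnear (c ε : ℝ) (hε : 0 < ε) :
      ∀ᶠ t : NNReal in 𝓝[>] 0, ∀ s ∈ Set.Icc c (c + t), p (f s - f c) ≤ ε := by
    obtain ⟨δ, hδ, hball⟩ := Metric.eventually_nhds_iff.1 ((hf c p hp).eventually_le_const hε)
    filter_upwards [((NNReal.continuous_coe.tendsto 0).mono_left
      nhdsWithin_le_nhds).eventually_lt_const hδ] with t ht s hs
    exact hball (by rw [Real.dist_eq, abs_of_nonneg (sub_nonneg.2 hs.1)]; linarith [hs.2])
  rw [Metric.tendsto_nhds]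
  intro ε hε
  filter_upwards [hnear b (ε / 3) (by positivity), hnear a (ε / 3) (by positivity),
    self_mem_nhdsWithin] with t hb ha ht
  rw [Real.dist_eq, sub_zero, abs_of_nonneg (apply_nonneg p _)]
  have ht : (0 : ℝ) < t := ht
  have hle := seminorm_inv_smul_sub_le ht ((hI t).seminorm_sub_sub_le hJ hf hp ht.le hb ha)
  exact hle.trans_lt (by linarith)

end Integral

/-! ### Integrated orbits and the range condition -/

section Range

variable {τ : AuxTopology X} {Γ : Set (Seminorm 𝕜 X)} {A : X →ₗ.[𝕜] X} {T : NNReal → X →L[𝕜] X}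

/-- The orbit `t ↦ T(t) z`, extended to negative times by its initial value. -/
def orbit (T : NNReal → X →L[𝕜] X) (z : X) (t : ℝ) : X :=
  T t.toNNReal z

/-- The rescaled semigroup `t ↦ e^(-l t) T(t)`. -/
noncomputable def rescale (l : ℝ) (T : NNReal → X →L[𝕜] X) (t : NNReal) : X →L[𝕜] X :=
  ((Real.exp (-(l * t)) : ℝ) : 𝕜) • T t

/-- The pair `(x, y)` belongs to the graph of the generator of `T`. -/
def InGeneratorGraph (Γ : Set (Seminorm 𝕜 X)) (T : NNReal → X →L[𝕜] X) (x y : X) : Prop :=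
  HasSeminormDerivAtZero Γ T x y ∧
    ∃ C : ℝ, ∀ t : NNReal, 0 < t → t ≤ 1 → ‖T t x - x‖ / (t : ℝ) ≤ C

theorem IsGenerator.exists_apply_eq (hA : IsGenerator τ T A) (hΓ : IsFundamentalSystem τ Γ)
    (hτ : @PolynormableSpace 𝕜 X _ _ _ τ.top) (hN : IsNorming Γ) {x y : X}
    (hxy : InGeneratorGraph Γ T x y) : ∃ v : A.domain, (v : X) = x ∧ A v = y := by
  have hx : x ∈ A.domain :=
    (hA.mem_domain_iff x).2 ⟨⟨y, (hΓ.hasTauDerivAtZero_iff hτ).2 hxy.1⟩, hxy.2⟩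
  exact ⟨⟨x, hx⟩, rfl, SeminormTendsto.unique hN
    ((hΓ.hasTauDerivAtZero_iff hτ).1 (hA.hasTauDeriv ⟨x, hx⟩)) hxy.1⟩

namespace IsBiContinuousSemigroup

theorem map_orbit (hT : IsBiContinuousSemigroup τ T) (z : X) {s : ℝ} (hs : 0 ≤ s) (t : NNReal) :
    T t (orbit T z s) = orbit T z (s + t) := by
  rw [orbit, orbit, Real.toNNReal_add hs t.coe_nonneg, Real.toNNReal_coe, add_comm, hT.map_add]
  rfl

theorem map_riemannSum_orbit (hT : IsBiContinuousSemigroup τ T) (z : X) {a h : ℝ} (ha : 0 ≤ a)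
    (hh : 0 ≤ h) (t : NNReal) (n : ℕ) :
    T t (riemannSum 𝕜 (orbit T z) a h n) = riemannSum 𝕜 (orbit T z) (a + t) h n := by
  simp only [riemannSum, map_smul, map_sum, add_right_comm a (t : ℝ)]
  congr! 2 with k
  exact hT.map_orbit z (by positivity) t

theorem seminormContinuous_orbit (hT : IsBiContinuousSemigroup τ T)
    (hΓ : IsFundamentalSystem τ Γ) (hτ : @PolynormableSpace 𝕜 X _ _ _ τ.top) (z : X) :
    SeminormContinuous Γ (orbit T z) := fun t p hp =>
  ((hΓ.tendsto_nhds_iff hτ).1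
    (@Continuous.tendsto _ _ _ τ.top _ (hT.stronglyContinuous z) t.toNNReal) p hp).comp
    (continuous_real_toNNReal.tendsto t)

theorem exists_norm_orbit_le (hT : IsBiContinuousSemigroup τ T) (z : X) (r : ℝ) :
    ∃ C, ∀ t ≤ r, ‖orbit T z t‖ ≤ C := by
  obtain ⟨M, ω, hM, hbound⟩ := hT.exponentiallyBounded
  refine ⟨M * Real.exp (|ω| * r.toNNReal) * ‖z‖, fun t ht => ?_⟩
  refine (T t.toNNReal).le_of_opNorm_le ((hbound _).trans ?_) z
  gcongr
  exact le_abs_self ω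

theorem seminormTendsto_map (hT : IsBiContinuousSemigroup τ T) (hΓ : IsFundamentalSystem τ Γ)
    (hτ : @PolynormableSpace 𝕜 X _ _ _ τ.top) {u : ℕ → X} {x : X} (hu : NormBounded u)
    (hux : SeminormTendsto Γ u atTop x) (t : NNReal) :
    SeminormTendsto Γ (fun n => T t (u n)) atTop (T t x) := by
  obtain ⟨C, hC⟩ := hu
  have hbounded : NormBounded fun n => u n - x :=
    ⟨C + ‖x‖, fun n => (norm_sub_le _ _).trans (add_le_add_left (hC n) _)⟩
  have hnull : Tendsto (fun n => u n - x) atTop (@nhds X τ.top 0) :=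
    (hΓ.tendsto_nhds_iff hτ).2 (by simpa using hux.sub (SeminormTendsto.const x))
  have hTnull : Tendsto (fun n => T t (u n - x)) atTop (@nhds X τ.top 0) := fun U hU =>
    (hT.locallyBiEquicontinuous _ hbounded hnull t U hU).mono fun n hn => hn t le_rfl
  simpa using ((hΓ.tendsto_nhds_iff hτ).1 hTnull).add (SeminormTendsto.const (T t x))

/-- `J` is the integral of the orbit of `z` over `[0, r]`. -/
theorem exists_inGeneratorGraph (hT : IsBiContinuousSemigroup τ T)
    (hΓ : IsFundamentalSystem τ Γ) (hτ : IsBiAdmissible 𝕜 τ) (hN : IsNorming Γ) (z : X)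
    (r : NNReal) : ∃ J, InGeneratorGraph Γ T J (T r z - z) := by
  obtain ⟨C, hC⟩ := hT.exists_norm_orbit_le z (r + 1)
  have hcont := hT.seminormContinuous_orbit hΓ hτ.locallyConvex z
  have hCr (t : ℝ) (ht : t ∈ Set.Icc (0 : ℝ) (0 + r)) : ‖orbit T z t‖ ≤ C :=
    hC t (by linarith [ht.2])
  obtain ⟨J, hJ⟩ :=
    hcont.exists_seminormTendsto_riemannSum (hΓ.isBoundedlyComplete hτ) r.2 hCr
  have hshift (t : NNReal) : IsPettisIntegral Γ (orbit T z) (0 + t) (0 + r + t) (T t J) := by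
    have hsum := hT.seminormTendsto_map hΓ hτ.locallyConvex
      ⟨_, norm_riemannSum_le r.2 hCr⟩ hJ t
    simp only [hT.map_riemannSum_orbit z le_rfl r.2] at hsum
    rw [add_right_comm]
    exact hcont.isPettisIntegral r.2 hsum
  have hJ' := hcont.isPettisIntegral r.2 hJ
  refine ⟨J, ?_, C + C, fun t ht ht1 => ?_⟩
  · simpa [orbit, hT.map_zero, HasSeminormDerivAtZero] using
      IsPettisIntegral.tendsto_inv_smul_sub hshift hJ' hcont
  · replace ht1 : (t : ℝ) ≤ 1 := ht1
    rw [div_le_iff₀' (NNReal.coe_pos.2 ht)]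
    refine hN.norm_le fun p hp => ?_
    have hle := (hshift t).seminorm_sub_sub_le (u := 0) (v := 0) (ε := C) (ε' := C) hJ' hcont hp
      t.2 (fun s hs => ?_) (fun s hs => ?_)
    · simpa using hle
    · rw [sub_zero]
      exact (hN.le_norm hp _).trans (hC s (by linarith [hs.2]))
    · rw [sub_zero]
      exact (hN.le_norm hp _).trans (hC s (by linarith [hs.2, r.2]))

end IsBiContinuousSemigroup

theorem IsBiContinuousSemigroup.rescale (hT : IsBiContinuousSemigroup τ T)
    (hΓ : IsFundamentalSystem τ Γ) (hτ : @PolynormableSpace 𝕜 X _ _ _ τ.top) (l : ℝ) :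
    IsBiContinuousSemigroup τ (rescale l T) where
  map_add t s := by
    ext x
    simp only [BiCont.rescale, hT.map_add, smul_apply, map_smul, smul_smul,
      ContinuousLinearMap.comp_apply, NNReal.coe_add, mul_add, neg_add, Real.exp_add,
      RCLike.ofReal_mul]
    rw [mul_comm]
  map_zero := by simp [BiCont.rescale, hT.map_zero]
  stronglyContinuous x := (@continuous_iff_continuousAt _ _ _ τ.top _).2 fun t =>
    (hΓ.tendsto_nhds_iff hτ).2 <| by
      have hexp : Continuous fun t : NNReal => ((Real.exp (-(l * t)) : ℝ) : 𝕜) := by fun_prop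
      exact SeminormTendsto.smul (hexp.tendsto t) ((hΓ.tendsto_nhds_iff hτ).1
        (@Continuous.tendsto _ _ _ τ.top _ (hT.stronglyContinuous x) t))
  exponentiallyBounded := by
    obtain ⟨M, ω, hM, hbound⟩ := hT.exponentiallyBounded
    refine ⟨M, ω - l, hM, fun t => ?_⟩
    rw [BiCont.rescale, norm_smul, RCLike.norm_ofReal, abs_of_pos (Real.exp_pos _), sub_mul,
      sub_eq_neg_add, Real.exp_add, mul_left_comm]
    gcongr
    exact hbound t
  locallyBiEquicontinuous u hb hu t₀ U hU := by
    obtain ⟨p, hp, ε, hε, hsub⟩ := hΓ.exists_ball_subset U hU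
    have hball : ∀ᶠ y in @nhds X τ.top 0, p (y - 0) < ε / Real.exp (|l| * t₀) :=
      ((hΓ.tendsto_nhds_iff hτ).1 tendsto_id p hp).eventually_lt_const (by positivity)
    filter_upwards [hT.locallyBiEquicontinuous u hb hu t₀ _ hball] with n hn s hs
    have hns : p (T s (u n)) < ε / Real.exp (|l| * t₀) := by simpa using hn s hs
    have hexp : -(l * s) ≤ |l| * t₀ := by
      rw [← neg_mul]
      exact mul_le_mul (neg_le_abs l) hs s.2 (abs_nonneg l)
    apply hsub
    change p (((Real.exp (-(l * s)) : ℝ) : 𝕜) • T s (u n)) < ε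
    rw [map_smul_eq_mul, RCLike.norm_ofReal, abs_of_pos (Real.exp_pos _)]
    calc Real.exp (-(l * s)) * p (T s (u n)) ≤ Real.exp (|l| * t₀) * p (T s (u n)) := by gcongr
      _ < ε := (lt_div_iff₀' (Real.exp_pos _)).1 hns

theorem abs_exp_sub_one_le_mul_exp_abs (x : ℝ) : |Real.exp x - 1| ≤ |x| * Real.exp |x| := by
  have hle := Complex.norm_exp_sub_sum_le_norm_mul_exp x 1
  rw [Finset.sum_range_one, pow_zero, Nat.factorial_zero, Nat.cast_one, div_one, pow_one,
    Complex.norm_real, Real.norm_eq_abs] at hle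
  rwa [← Complex.ofReal_exp, ← Complex.ofReal_one, ← Complex.ofReal_sub, Complex.norm_real,
    Real.norm_eq_abs] at hle

theorem apply_sub_eq_rescale (l : ℝ) (T : NNReal → X →L[𝕜] X) (t : NNReal) (x : X) :
    T t x - x = ((Real.exp (l * t) : ℝ) : 𝕜) • (rescale l T t x - x) +
      ((Real.exp (l * t) - 1 : ℝ) : 𝕜) • x := by
  have hT : ((Real.exp (l * t) : ℝ) : 𝕜) • rescale l T t x = T t x := by
    rw [rescale, smul_apply, smul_smul, ← RCLike.ofReal_mul, ← Real.exp_add, add_neg_cancel,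
      Real.exp_zero, RCLike.ofReal_one, one_smul]
  rw [smul_sub, hT, RCLike.ofReal_sub, RCLike.ofReal_one]
  module

theorem tendsto_inv_mul_exp_mul_sub_one (l : ℝ) :
    Tendsto (fun t : NNReal => ((t : ℝ) : 𝕜)⁻¹ * ((Real.exp (l * t) - 1 : ℝ) : 𝕜)) (𝓝[>] 0)
      (𝓝 (l : 𝕜)) := by
  have hcoe : Tendsto (fun t : NNReal => (t : ℝ)) (𝓝[>] 0) (𝓝[≠] 0) :=
    tendsto_nhdsWithin_iff.2 ⟨(NNReal.continuous_coe.tendsto 0).mono_left nhdsWithin_le_nhds,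
      eventually_mem_of_tendsto_nhdsWithin tendsto_id |>.mono fun t ht => (NNReal.coe_pos.2 ht).ne'⟩
  have hderiv : HasDerivAt (fun t => Real.exp (l * t)) l 0 := by
    simpa using ((hasDerivAt_id (0 : ℝ)).const_mul l).exp
  have hslope := (RCLike.continuous_ofReal (K := 𝕜)).tendsto l |>.comp
    (hderiv.tendsto_slope_zero.comp hcoe)
  simpa [Function.comp_def] using hslope

theorem HasSeminormDerivAtZero.of_rescale {l : ℝ} {x y : X}
    (hxy : HasSeminormDerivAtZero Γ (rescale l T) x y) :
    HasSeminormDerivAtZero Γ T x (y + (l : 𝕜) • x) := by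
  have hexp : Tendsto (fun t : NNReal => ((Real.exp (l * t) : ℝ) : 𝕜)) (𝓝[>] 0) (𝓝 1) := by
    have hcont : Continuous fun t : NNReal => ((Real.exp (l * t) : ℝ) : 𝕜) := by fun_prop
    simpa using (hcont.tendsto 0).mono_left nhdsWithin_le_nhds
  have hlim := (SeminormTendsto.smul hexp hxy).add
    (.smul (tendsto_inv_mul_exp_mul_sub_one l) (.const x))
  rw [one_smul] at hlim
  unfold HasSeminormDerivAtZero
  convert hlim using 2 with t
  rw [apply_sub_eq_rescale l T t x]
  module

theorem InGeneratorGraph.of_rescale {l : ℝ} {x y : X}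
    (hxy : InGeneratorGraph Γ (rescale l T) x y) :
    InGeneratorGraph Γ T x (y + (l : 𝕜) • x) := by
  obtain ⟨hderiv, C, hC⟩ := hxy
  refine ⟨hderiv.of_rescale, Real.exp |l| * C + |l| * Real.exp |l| * ‖x‖, fun t ht ht1 => ?_⟩
  have hS := hC t ht ht1
  have ht' : (0 : ℝ) < t := ht
  replace ht1 : (t : ℝ) ≤ 1 := ht1
  rw [div_le_iff₀ ht'] at hS ⊢
  have habs : |l * t| ≤ |l| := by
    rw [abs_mul, abs_of_pos ht']
    exact mul_le_of_le_one_right (abs_nonneg l) ht1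
  have hexp : Real.exp (l * t) ≤ Real.exp |l| := Real.exp_le_exp.2 ((le_abs_self _).trans habs)
  have hexp' : |Real.exp (l * t) - 1| ≤ |l| * t * Real.exp |l| := by
    refine (abs_exp_sub_one_le_mul_exp_abs _).trans ?_
    rw [abs_mul, abs_of_pos ht']
    rw [abs_mul, abs_of_pos ht'] at habs
    gcongr
  rw [apply_sub_eq_rescale l T t x]
  calc ‖((Real.exp (l * t) : ℝ) : 𝕜) • (rescale l T t x - x) +
        ((Real.exp (l * t) - 1 : ℝ) : 𝕜) • x‖
      ≤ Real.exp (l * t) * ‖rescale l T t x - x‖ + |Real.exp (l * t) - 1| * ‖x‖ := by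
        refine (norm_add_le _ _).trans_eq ?_
        rw [norm_smul, norm_smul, RCLike.norm_ofReal, RCLike.norm_ofReal,
          abs_of_pos (Real.exp_pos _)]
    _ ≤ Real.exp |l| * (C * t) + |l| * t * Real.exp |l| * ‖x‖ := by gcongr
    _ = (Real.exp |l| * C + |l| * Real.exp |l| * ‖x‖) * t := by ring

theorem IsGenerator.surjective_shifted [CompleteSpace X] (hA : IsGenerator τ T A)
    (hT : IsBiContinuousSemigroup τ T) (hΓ : IsFundamentalSystem τ Γ) (hτ : IsBiAdmissible 𝕜 τ)
    (hN : IsNorming Γ) {l : ℝ} {r : NNReal} (hr : ‖rescale l T r‖ < 1) :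
    Function.Surjective (shifted A l) := by
  intro y
  obtain ⟨z, rfl⟩ := surjective_one_sub hr y
  obtain ⟨J, hJ⟩ :=
    (hT.rescale hΓ hτ.locallyConvex l).exists_inGeneratorGraph hΓ hτ hN z r
  obtain ⟨v, rfl, hAv⟩ := hA.exists_apply_eq hΓ hτ.locallyConvex hN hJ.of_rescale
  refine ⟨v, ?_⟩
  change shifted A l v = z - rescale l T r z
  rw [shifted_apply, hAv]
  abel

theorem norm_rescale_lt_one {t : NNReal} (ht : 0 < t) (hT : ‖T t‖ ≤ 1) {l : ℝ} (hl : 0 < l) :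
    ‖rescale l T t‖ < 1 := by
  rw [rescale, norm_smul, RCLike.norm_ofReal, abs_of_pos (Real.exp_pos _)]
  exact mul_lt_one_of_nonneg_of_lt_one_left (Real.exp_pos _).le
    (Real.exp_lt_one_iff.2 (neg_neg_of_pos (mul_pos hl ht))) hT

end Range

end BiCont

theorem theorem3p5_general {𝕜 X : Type*} [RCLike 𝕜] [NormedAddCommGroup X] [NormedSpace 𝕜 X]
    [CompleteSpace X] (τ : BiCont.AuxTopology X) (hτ : BiCont.IsBiAdmissible 𝕜 τ)
    (A : X →ₗ.[𝕜] X) (hdiss : BiCont.BiDissipative τ A)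
    (hdense : @Dense X τ.top (A.domain : Set X)) :
    BiCont.GeneratesContractionSemigroup τ A ↔
      ∃ l : ℝ, 0 < l ∧ ∀ y : X, ∃ x : A.domain, (l : 𝕜) • (x : X) - A x = y := by
  obtain ⟨Γ, hΓ, hA, hN⟩ := hdiss
  constructor
  · rintro ⟨T, hT, hcontr, hgen⟩
    exact ⟨1, one_pos, hgen.surjective_shifted hT hΓ hτ hN
      (BiCont.norm_rescale_lt_one one_pos (hcontr 1) one_pos)⟩
  · rintro ⟨l, hl, hs⟩
    exact BiCont.IsDissipativeFor.generatesContractionSemigroup hA hΓ hN hτ hdense hl hs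

theorem theorem3p5 {𝕜 X : Type*} [RCLike 𝕜] [NormedAddCommGroup X] [NormedSpace 𝕜 X]
    [CompleteSpace X] (τ : BiCont.AuxTopology X) (hτ : BiCont.IsBiAdmissible 𝕜 τ)
    (A : X →ₗ.[𝕜] X) (hdiss : BiCont.BiDissipative τ A) (hdense : BiCont.BiDenselyDefined τ A)
    (hclosed : A.IsClosed) :
    BiCont.GeneratesContractionSemigroup τ A ↔
      ∃ l : ℝ, 0 < l ∧ ∀ y : X, ∃ x : A.domain, (l : 𝕜) • (x : X) - A x = y :=
  theorem3p5_general τ hτ A hdiss hdense.dense
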